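/- Let $\mathcal G_{2n}$ be the real Clifford algebra of the Euclidean space $\mathbb R^{2n}$ with orthonormal basis $e_1,\dots,e_n,e'_1,\dots,e'_n$, with $x^2=x\cdot x$ for vectors, and with the norm $|A|=\langle AA^\dagger\rangle_0^{1/2}$, where $\dagger$ is the reversion and $\langle\cdot\rangle_0$ the scalar part; thus $|A|^2=\sum_I\alpha_I^2$ for $A=\sum_I\alpha_Ie_I$. Identify $\mathbb R^n$ with the span of $e_1,\dots,e_n$, and write vectors of $\mathbb R^{2n}$ as $y+y'=\sum_i y_ie_i+\sum_i y'_ie'_i$ with $y,y'\in\mathbb R^n$. Put $B_i=e_ie'_i$, let $P_i$ be the orthogonal projection of $\mathbb R^{2n}$ onto the span of $e_i,e'_i$, and let $$I(u,v)=\sum_{i=1}^n B_iP_i(u)P_i(v)\in\mathcal G_{2n}\qquad(u,v\in\mathbb R^{2n}).$$ Let $dm(x)=(2\pi)^{-n/2}dx$ on $\mathbb R^n$, let $L_2=L_2(\mathbb R^n,m;\mathcal G_{2n})$ with norm $\|F\|_2=\big(\int_{\mathbb R^n}|F|^2\,dm\big)^{1/2}$, and, wherever the integral exists, let $$(\mathcal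 F_1F)(v)=\int_{\mathbb R^n}e^{-I(x,v)}F(x)\,dm(x),\qquad v\in\mathbb R^{2n}.$$ Let $\Pi^{2n}_-=\{y+y' : y\in\mathbb R^n,\ y'\in(-\infty,0)^n\}\subseteq\mathbb R^{2n}$. A function $f$ with values in $\mathcal G_{2n}$ is called monogenic with respect to $B_i$ in $\Pi^{2n}_-$ if it is of class $C^1$ there and $e_i\,\partial f/\partial y_i+e'_i\,\partial f/\partial y'_i=0$ at every point of $\Pi^{2n}_-$. Write $f_{y'}(y)=f(y+y')$. **Theorem 4.3.** 1. Let $F\in L_2$ vanish (almost everywhere) outside $(0,\infty)^n$. Then for every $v\in\Pi^{2n}_-$ the integral defining $(\mathcal F_1F)(v)$ converges absolutely, the function $f=\mathcal F_1F$ is monogenic with respect to each $B_i$, $i=1,\dots,n$, in $\Pi^{2n}_-$, and $$\sup_{y'\in(-\infty,0)^n}\int_{\mathbb R^n}|f_{y'}(y)|^2\,dm(y)=\|F\|_2^2 .$$ 2. Conversely, let $f$ be monogenic with respect to each $B_i$, $i=1,\dots,n$, in $\Pi^{2n}_-$, and suppose that $$\sup_{y'\in(-\infty,0)^n}\int_{\mathbb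 R^n}|f_{y'}(y)|^2\,dm(y)=C<\infty .$$ Then there is $F\in L_2$ vanishing outside $(0,\infty)^n$ such that, for every $v\in\Pi^{2n}_-$, the integral defining $(\mathcal F_1F)(v)$ converges absolutely and $f(v)=(\mathcal F_1F)(v)$; moreover $C=\|F\|_2^2$. -/

import Mathlib

open MeasureTheory
open scoped ENNReal NNReal

noncomputable section

namespace CliffordFourier

/-- The space `ℝⁿ`. -/
abbrev Rn (n : ℕ) : Type := EuclideanSpace ℝ (Fin n)

/-- The space `ℝ²ⁿ`, whose standard orthonormal basis is `e₁, …, eₙ, e'₁, …, e'ₙ`: the left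
summand of the index type lists the `eᵢ`, the right one the `e'ᵢ`. -/
abbrev R2n (n : ℕ) : Type := EuclideanSpace ℝ (Fin n ⊕ Fin n)

/-- The quadratic form `x ↦ x · x` of `ℝ²ⁿ`. -/
def quadForm (n : ℕ) : QuadraticForm ℝ (R2n n) :=
  LinearMap.BilinMap.toQuadraticMap (innerₗ (R2n n))

/-- The real Clifford algebra of `ℝ²ⁿ`, with `x² = x · x` for vectors. -/
abbrev G (n : ℕ) : Type := CliffordAlgebra (quadForm n)

/-- A vector of `ℝ²ⁿ` as an element of the Clifford algebra. -/
def vec {n : ℕ} (v : R2n n) : G n := CliffordAlgebra.ι (quadForm n) v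

/-- The scalar component `⟨A⟩₀` of a multivector: the degree zero component of its image in the
exterior algebra, under the canonical linear identification (which sends a product of distinct
orthonormal basis vectors to their exterior product). -/
def scalarPart {n : ℕ} : G n →ₗ[ℝ] ℝ :=
  (ExteriorAlgebra.algebraMapInv (R := ℝ) (M := R2n n)).toLinearMap ∘ₗ
    (CliffordAlgebra.equivExterior (quadForm n)).toLinearMap

/-- The scalar product of multivectors `A · B = ⟨A B†⟩₀`, where `†` is the reversion. -/
def scalarProd {n : ℕ} (A B : G n) : ℝ := scalarPart (A * CliffordAlgebra.reverse B)

/-! ### The scalar product is positive definite -/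

/-- The orthonormal basis vectors of `ℝ²ⁿ` inside the Clifford algebra. -/
def gen {n : ℕ} (j : Fin n ⊕ Fin n) : G n := vec (EuclideanSpace.single j 1)

/-- The product of the basis vectors indexed by a finite set, in some order. -/
def blade {n : ℕ} (I : Finset (Fin n ⊕ Fin n)) : G n := (I.toList.map gen).prod

theorem gen_sq {n : ℕ} (j : Fin n ⊕ Fin n) : (gen j : G n) * gen j = 1 := by
  unfold gen vec
  rw [CliffordAlgebra.ι_sq_scalar]
  have h : quadForm n (EuclideanSpace.single j 1) = 1 := by simp [quadForm]
  rw [h, map_one]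

theorem gen_anticomm {n : ℕ} {i j : Fin n ⊕ Fin n} (h : i ≠ j) :
    (gen i : G n) * gen j = -(gen j * gen i) := by
  unfold gen vec
  apply CliffordAlgebra.ι_mul_ι_comm_of_isOrtho
  rw [QuadraticMap.isOrtho_def]
  simp [quadForm, inner_add_right, EuclideanSpace.inner_single_left, h, h.symm]

theorem prod_perm {n : ℕ} {l l' : List (Fin n ⊕ Fin n)} (h : l.Perm l') :
    (l.map gen).prod = ((l'.map gen).prod : G n) ∨
      (l.map gen).prod = -((l'.map gen).prod : G n) := by
  induction h with
  | nil => simp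
  | cons x _ ih =>
    rcases ih with ih | ih
    · left; simp [ih]
    · right; simp [ih]
  | swap x y l =>
    by_cases hxy : y = x
    · left; simp [hxy]
    · right
      simp only [List.map_cons, List.prod_cons]
      rw [← mul_assoc, gen_anticomm hxy, neg_mul, mul_assoc]
  | trans _ _ ih1 ih2 =>
    rcases ih1 with h1 | h1 <;> rcases ih2 with h2 | h2 <;> simp [h1, h2]

theorem blade_empty {n : ℕ} : (blade ∅ : G n) = 1 := by simp [blade]

theorem blade_insert {n : ℕ} {I : Finset (Fin n ⊕ Fin n)} {j : Fin n ⊕ Fin n} (h : j ∉ I) :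
    (blade (insert j I) : G n) = gen j * blade I ∨
      (blade (insert j I) : G n) = -(gen j * blade I) := by
  simpa [blade] using prod_perm (n := n) (Finset.toList_insert h)

theorem gen_mul_blade {n : ℕ} (j : Fin n ⊕ Fin n) (I : Finset (Fin n ⊕ Fin n)) :
    (gen j : G n) * blade I = blade (symmDiff {j} I) ∨
      (gen j : G n) * blade I = -blade (symmDiff {j} I) := by
  by_cases h : j ∈ I
  · have hs : symmDiff {j} I = I.erase j := by
      ext x; by_cases hx : x = j <;> simp [Finset.mem_symmDiff, hx, h]
    have hI : insert j (I.erase j) = I := Finset.insert_erase h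
    rw [hs]
    rcases blade_insert (n := n) (Finset.notMem_erase j I) with h1 | h1
    · left; rw [hI] at h1; rw [h1, ← mul_assoc, gen_sq, one_mul]
    · right; rw [hI] at h1; rw [h1, mul_neg, ← mul_assoc, gen_sq, one_mul]
  · have hs : symmDiff {j} I = insert j I := by
      ext x; by_cases hx : x = j <;> simp [Finset.mem_symmDiff, hx, h]
    rw [hs]
    rcases blade_insert (n := n) h with h1 | h1
    · left; rw [h1]
    · right; rw [h1, neg_neg]

theorem blade_mul_blade {n : ℕ} (I J : Finset (Fin n ⊕ Fin n)) :
    (blade I : G n) * blade J = blade (symmDiff I J) ∨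
      (blade I : G n) * blade J = -blade (symmDiff I J) := by
  induction I using Finset.induction_on with
  | empty =>
    left
    have : symmDiff (∅ : Finset (Fin n ⊕ Fin n)) J = J := bot_symmDiff J
    rw [this, blade_empty, one_mul]
  | insert j I hj ih =>
    have hs : insert j I = symmDiff {j} I := by
      ext x; by_cases hx : x = j <;> simp [Finset.mem_symmDiff, hx, hj]
    have hss : symmDiff (insert j I) J = symmDiff {j} (symmDiff I J) := by
      rw [hs, symmDiff_assoc]
    rw [hss]
    rcases blade_insert (n := n) hj with h1 | h1 <;> rcases ih with h2 | h2 <;>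
      rcases gen_mul_blade (n := n) j (symmDiff I J) with h3 | h3 <;>
      simp [h1, mul_assoc, h2, h3]

theorem reverse_blade {n : ℕ} (I : Finset (Fin n ⊕ Fin n)) :
    CliffordAlgebra.reverse (blade I : G n) = blade I ∨
      CliffordAlgebra.reverse (blade I : G n) = -blade I := by
  have h : CliffordAlgebra.reverse (blade I : G n) = (I.toList.reverse.map gen).prod := by
    unfold blade
    induction I.toList with
    | nil => simp
    | cons x l ih =>
      simp only [List.map_cons, List.prod_cons, CliffordAlgebra.reverse.map_mul, ih,
        List.reverse_cons, List.map_append, List.prod_append, List.map_nil, List.prod_nil,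
        mul_one]
      simp [gen, vec]
  rw [h]
  exact prod_perm (List.reverse_perm _)

theorem blade_mul_reverse_self {n : ℕ} (I : Finset (Fin n ⊕ Fin n)) :
    (blade I : G n) * CliffordAlgebra.reverse (blade I) = 1 := by
  unfold blade
  induction I.toList with
  | nil => simp
  | cons x l ih =>
    have hx : CliffordAlgebra.reverse (gen x : G n) = gen x := by simp [gen, vec]
    simp only [List.map_cons, List.prod_cons, CliffordAlgebra.reverse.map_mul, hx]
    rw [mul_assoc, ← mul_assoc _ _ (gen x), ih, one_mul, gen_sq]

theorem equivExterior_prod {n : ℕ} {l : List (Fin n ⊕ Fin n)} (hl : l.Nodup) :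
    CliffordAlgebra.equivExterior (quadForm n) ((l.map gen).prod : G n) =
      (l.map fun j => ExteriorAlgebra.ι ℝ (EuclideanSpace.single j (1 : ℝ) : R2n n)).prod := by
  induction l with
  | nil => simp
  | cons x l ih =>
    have hx : x ∉ l := (List.nodup_cons.1 hl).1
    have ih' := ih (List.nodup_cons.1 hl).2
    simp only [List.map_cons, List.prod_cons]
    rw [CliffordAlgebra.equivExterior, CliffordAlgebra.changeFormEquiv_apply] at ih' ⊢
    unfold gen vec at ih' ⊢
    rw [CliffordAlgebra.changeForm_ι_mul, ih']
    refine sub_eq_self.2 ?_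
    clear ih ih' hl
    induction l with
    | nil => simp
    | cons y l ih =>
      have hxy : x ≠ y := fun h => hx (by simp [h])
      have hxl : x ∉ l := fun h => hx (by simp [h])
      simp only [List.map_cons, List.prod_cons]
      unfold ExteriorAlgebra.ι at ih ⊢
      rw [CliffordAlgebra.contractLeft_ι_mul, ih hxl]
      simp [quadForm, QuadraticMap.associated_apply, inner_add_right,
        EuclideanSpace.inner_single_left, hxy, hxy.symm]

theorem scalarPart_blade {n : ℕ} {I : Finset (Fin n ⊕ Fin n)} (h : I ≠ ∅) :
    scalarPart (blade I : G n) = 0 := by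
  have h1 := equivExterior_prod (n := n) (Finset.nodup_toList I)
  simp only [scalarPart, LinearMap.comp_apply, blade, LinearEquiv.coe_coe, h1,
    AlgHom.toLinearMap_apply]
  cases hI : I.toList with
  | nil => exact absurd (Finset.toList_eq_nil.1 hI) h
  | cons x l => simp [ExteriorAlgebra.algebraMapInv]

theorem scalarPart_one {n : ℕ} : scalarPart (1 : G n) = 1 := by
  simp [scalarPart, ExteriorAlgebra.algebraMapInv]

theorem scalarProd_blade {n : ℕ} (I J : Finset (Fin n ⊕ Fin n)) :
    scalarProd (blade I : G n) (blade J) = if I = J then 1 else 0 := by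
  unfold scalarProd
  split_ifs with h
  · rw [h, blade_mul_reverse_self, scalarPart_one]
  · have hne : symmDiff I J ≠ ∅ := fun h0 => h (symmDiff_eq_bot.1 h0)
    rcases reverse_blade (n := n) J with h1 | h1 <;>
      rcases blade_mul_blade (n := n) I J with h2 | h2 <;>
      simp [h1, h2, scalarPart_blade hne]

theorem span_blade {n : ℕ} :
    Submodule.span ℝ (Set.range (blade : Finset (Fin n ⊕ Fin n) → G n)) = ⊤ := by
  rw [Submodule.eq_top_iff']
  intro x
  induction x using CliffordAlgebra.left_induction with
  | algebraMap r =>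
    rw [Algebra.algebraMap_eq_smul_one, ← blade_empty]
    exact Submodule.smul_mem _ _ (Submodule.subset_span ⟨_, rfl⟩)
  | add x y hx hy => exact Submodule.add_mem _ hx hy
  | ι_mul x m hx =>
    have hm : CliffordAlgebra.ι (quadForm n) m = ∑ j, m j • (gen j : G n) := by
      have : m = ∑ j, m j • (EuclideanSpace.single j (1 : ℝ) : R2n n) := by
        ext i; cases i <;> simp [Pi.single_apply]
      conv_lhs => rw [this]
      simp [gen, vec]
    rw [hm, Finset.sum_mul]
    refine Submodule.sum_mem _ fun j _ => ?_
    rw [smul_mul_assoc]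
    refine Submodule.smul_mem _ _ ?_
    induction hx using Submodule.span_induction with
    | mem y hy =>
      obtain ⟨I, rfl⟩ := hy
      rcases gen_mul_blade (n := n) j I with h | h <;> rw [h]
      · exact Submodule.subset_span ⟨_, rfl⟩
      · exact Submodule.neg_mem _ (Submodule.subset_span ⟨_, rfl⟩)
    | zero => simp
    | add y z _ _ hy hz => rw [mul_add]; exact Submodule.add_mem _ hy hz
    | smul a y _ hy => rw [mul_smul_comm]; exact Submodule.smul_mem _ _ hy

theorem exists_coord {n : ℕ} (A : G n) :
    ∃ a : Finset (Fin n ⊕ Fin n) → ℝ, A = ∑ I, a I • blade I := by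
  have h : A ∈ Submodule.span ℝ (Set.range (blade : Finset (Fin n ⊕ Fin n) → G n)) := by
    rw [span_blade]; trivial
  obtain ⟨a, ha⟩ := (Submodule.mem_span_range_iff_exists_fun ℝ).1 h
  exact ⟨a, ha.symm⟩

/-- In coordinates, the scalar product is `∑_I α_I β_I`; in particular `A · A = ∑_I α_I²`. -/
theorem scalarProd_coord {n : ℕ} (a b : Finset (Fin n ⊕ Fin n) → ℝ) :
    scalarProd (∑ I, a I • (blade I : G n)) (∑ I, b I • blade I) = ∑ I, a I * b I := by
  have h : ∀ I J, scalarPart ((blade I : G n) * CliffordAlgebra.reverse (blade J)) =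
      if I = J then 1 else 0 := scalarProd_blade
  simp [scalarProd, Finset.sum_mul, Finset.mul_sum, h, mul_comm]

/-- The scalar product of multivectors is an inner product. -/
@[reducible]
def innerCore (n : ℕ) : InnerProductSpace.Core ℝ (G n) where
  inner A B := scalarProd A B
  conj_inner_symm A B := by
    obtain ⟨a, rfl⟩ := exists_coord A
    obtain ⟨b, rfl⟩ := exists_coord B
    simp only [scalarProd_coord, conj_trivial]
    exact Finset.sum_congr rfl fun _ _ => mul_comm _ _
  re_inner_nonneg A := by
    obtain ⟨a, rfl⟩ := exists_coord A
    simp only [scalarProd_coord, RCLike.re_to_real]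
    exact Finset.sum_nonneg fun I _ => mul_self_nonneg (a I)
  add_left A B C := by simp [scalarProd, add_mul]
  smul_left A B r := by simp [scalarProd]
  definite A := by
    obtain ⟨a, rfl⟩ := exists_coord A
    simp only [scalarProd_coord]
    intro h
    have h0 := (Finset.sum_eq_zero_iff_of_nonneg fun I _ => mul_self_nonneg (a I)).1 h
    exact Finset.sum_eq_zero fun I hI => by simp [mul_self_eq_zero.1 (h0 I hI)]

/-- The norm `|A| = (A · A)^{1/2}` on the Clifford algebra. -/
instance instNormedAddCommGroupG (n : ℕ) : NormedAddCommGroup (G n) :=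
  (innerCore n).toNormedAddCommGroup

instance instInnerProductSpaceG (n : ℕ) : InnerProductSpace ℝ (G n) :=
  InnerProductSpace.ofCore (innerCore n).toCore

theorem norm_sq_eq {n : ℕ} (A : G n) : ‖A‖ ^ 2 = scalarPart (A * CliffordAlgebra.reverse A) :=
  (real_inner_self_eq_norm_sq A).symm

instance instFiniteDimensionalG (n : ℕ) : FiniteDimensional ℝ (G n) :=
  ⟨⟨(Set.finite_range (blade : Finset (Fin n ⊕ Fin n) → G n)).toFinset, by
    simpa using span_blade⟩⟩

instance instCompleteSpaceG (n : ℕ) : CompleteSpace (G n) := FiniteDimensional.complete ℝ (G n)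

instance instIsTopologicalRingG (n : ℕ) : IsTopologicalRing (G n) where
  continuous_mul := by
    have h : Continuous fun p : G n × G n =>
        LinearMap.toContinuousLinearMap
          ((LinearMap.toContinuousLinearMap :
            (G n →ₗ[ℝ] G n) ≃ₗ[ℝ] (G n →L[ℝ] G n)).toLinearMap ∘ₗ LinearMap.mul ℝ (G n))
          p.1 p.2 := by fun_prop
    exact h

/-! ### The Clifford-Fourier transform and its extension to `ℝ²ⁿ` -/

/-- The unit vector `eᵢ`. -/
def e {n : ℕ} (i : Fin n) : R2n n := EuclideanSpace.single (Sum.inl i) 1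

/-- The unit vector `e'ᵢ`. -/
def e' {n : ℕ} (i : Fin n) : R2n n := EuclideanSpace.single (Sum.inr i) 1

/-- The inclusion of `ℝⁿ` in `ℝ²ⁿ`, `x ↦ x₁ e₁ + ⋯ + xₙ eₙ`. -/
def incl {n : ℕ} (x : Rn n) : R2n n := ∑ i, x i • e i

/-- The vector `y'₁ e'₁ + ⋯ + y'ₙ e'ₙ`. -/
def incl' {n : ℕ} (y' : Rn n) : R2n n := ∑ i, y' i • e' i

/-- The bivector `Bᵢ = eᵢ e'ᵢ`. -/
def B {n : ℕ} (i : Fin n) : G n := vec (e i) * vec (e' i)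

/-- The orthogonal projection `Pᵢ` of `ℝ²ⁿ` onto the span of `eᵢ` and `e'ᵢ`. -/
def P {n : ℕ} (i : Fin n) (v : R2n n) : R2n n :=
  v (Sum.inl i) • e i + v (Sum.inr i) • e' i

/-- `I(u, v) = ∑ᵢ Bᵢ Pᵢ(u) Pᵢ(v)`, with products in the Clifford algebra. -/
def Iform {n : ℕ} (u v : R2n n) : G n := ∑ i, B i * vec (P i u) * vec (P i v)

/-- The normalized measure `dm = (2π)^{-n/2} dx` on `ℝⁿ`. -/
def m (n : ℕ) : Measure (Rn n) :=
  ENNReal.ofReal ((2 * Real.pi) ^ (-(n : ℝ) / 2)) • volume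

/-- The integrand `e^{-I(x, v)} F(x)` of the extended transform at the point `v` of `ℝ²ⁿ`. -/
def integrand {n : ℕ} (F : Rn n → G n) (v : R2n n) (x : Rn n) : G n :=
  NormedSpace.exp (-Iform (incl x) v) * F x

/-- The extension to `ℝ²ⁿ` of the Clifford-Fourier transform of `F`,
`v ↦ ∫ e^{-I(x, v)} F(x) dm(x)`. -/
def extTransform {n : ℕ} (F : Rn n → G n) (v : R2n n) : G n :=
  ∫ x, integrand F v x ∂m n

/-- `f` is (left-)monogenic with respect to `Bᵢ` in the open set `M`: it is of class `C¹` there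
and `eᵢ ∂f/∂xᵢ + e'ᵢ ∂f/∂x'ᵢ = 0`. -/
def MonogenicOn {n : ℕ} (i : Fin n) (f : R2n n → G n) (M : Set (R2n n)) : Prop :=
  ContDiffOn ℝ 1 f M ∧
    ∀ v ∈ M, vec (e i) * fderiv ℝ f v (e i) + vec (e' i) * fderiv ℝ f v (e' i) = 0

/-- The octant `(0, ∞)ⁿ`. -/
def posOctant (n : ℕ) : Set (Rn n) := {x | ∀ i, 0 < x i}

/-- The octant `(-∞, 0)ⁿ`. -/
def negOctant (n : ℕ) : Set (Rn n) := {x | ∀ i, x i < 0}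

/-- The tube `{y + y' | y ∈ ℝⁿ, y' ∈ (-∞, 0)ⁿ}` in `ℝ²ⁿ`. -/
def tube (n : ℕ) : Set (R2n n) := {v | ∃ y : Rn n, ∃ y' ∈ negOctant n, v = incl y + incl' y'}

/-- `sup_{y' ∈ (-∞, 0)ⁿ} ∫ |f(y + y')|² dm(y)`, as an extended nonnegative real. -/
def supSlice {n : ℕ} (f : R2n n → G n) : ℝ≥0∞ :=
  ⨆ y' ∈ negOctant n, ∫⁻ y, ‖f (incl y + incl' y')‖ₑ ^ 2 ∂m n

end CliffordFourier

end

/-! Left multiplications by the bivectors `B i` are commuting isometries of `G n` with square `-1`,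
so they can be diagonalized together. A `SpectralFrame` does this by real-linear functionals `coord
k : G n → ℂ`, a Parseval family, in which each `B i` acts as `± i`. In coordinate `k` the kernel
`e^{-I(x,v)}` becomes a scalar exponential (`coord_exp_mul`). The monogenic equation for `B i` says
that the `e' i`-derivative is `B i` times the `e i`-derivative (`monogenic_iff`), and becomes a
Cauchy-Riemann equation once the sign of `y i` is adjusted. The theorem thus reduces to the scalar
Paley-Wiener theorem for the tube over the negative octant.

Direct half: for `F` in `L²` supported in the positive octant, the weight `e^{2π⟪x, η⟫}` decays
exponentially there. Hence the integral converges and may be differentiated, and Plancherel turns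
the norm of each slice into a weighted norm of `F`. The weight is at most `1` on the octant and
tends to `1` as `η → 0`, so Fatou identifies the supremum.

Converse (`exists_eq_laplaceFourier`): let `H` be holomorphic in the tube with slices bounded in
`L²`. Undoing the weight on the inverse Fourier transform of a slice gives a function `F`
independent of `η`, by shifting the contour (`integral_slice_eq`) against test functions. The
uniform bound, with `η` going to infinity along a negative axis, forces `F = 0` outside the octant;
with `η → 0` it gives `F ∈ L²`. Fourier inversion and continuity then give `H = laplaceFourier F` at
every point. The equality of norms follows from the direct half. -/

noncomputable section

namespace CliffordFourier

open FourierTransform SchwartzMap Complex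
open scoped RealInnerProductSpace ContDiff Topology

set_option linter.unusedSectionVars false

/-! ### Plancherel for functions in `L¹ ∩ L²`. -/

section Plancherel

variable {V : Type*} [NormedAddCommGroup V] [InnerProductSpace ℝ V] [FiniteDimensional ℝ V]
  [MeasurableSpace V] [BorelSpace V]

/-- Both transforms obey the exchange formula `∫ 𝓕φ · f = ∫ φ · 𝓕f`, one as a tempered distribution
and the other by Fubini, so they agree against all test functions. -/
theorem Lp_fourier_ae_eq {f : V → ℂ} (h1 : Integrable f) (h2 : MemLp f 2) :
    (𝓕 (h2.toLp f) : Lp ℂ 2 (volume : Measure V)) =ᵐ[volume] 𝓕 f := by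
  have hc : Continuous (𝓕 f) :=
    VectorFourier.fourierIntegral_continuous Real.continuous_fourierChar
      (by exact continuous_inner) h1
  refine ae_eq_of_integral_contDiff_smul_eq
    ((Lp.memLp _).locallyIntegrable (by norm_num)) hc.locallyIntegrable ?_
  intro g hg hgs
  have hg1 : HasCompactSupport (Complex.ofRealCLM ∘ g) := hgs.comp_left rfl
  have hg2 : ContDiff ℝ ∞ (Complex.ofRealCLM ∘ g) := by fun_prop
  let φ : 𝓢(V, ℂ) := hg1.toSchwartzMap hg2
  have key := congrArg (fun T => T φ) (Lp.fourier_toTemperedDistribution_eq (h2.toLp f))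
  simp only [TemperedDistribution.fourier_apply, Lp.toTemperedDistribution_apply] at key
  have h3 : ∫ x, (𝓕 φ) x • (h2.toLp f) x = ∫ x, (𝓕 φ) x • f x := by
    refine integral_congr_ae ?_
    filter_upwards [h2.coeFn_toLp] with x hx
    rw [hx]
  have h4 : ∫ x, (𝓕 φ) x • f x = ∫ x, φ x • (𝓕 f) x := by
    have := VectorFourier.integral_fourierIntegral_smul_eq_flip (L := innerₗ V)
      (μ := (volume : Measure V)) (ν := (volume : Measure V))
      Real.continuous_fourierChar (by exact continuous_inner) φ.integrable h1
    rw [flip_innerₗ] at this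
    rw [SchwartzMap.fourier_coe]
    exact this
  have h5 : ∀ u : V → ℂ, ∫ x, g x • u x = ∫ x, φ x • u x := fun u => rfl
  rw [h5, h5, ← key, h3, h4]

theorem eLpNorm_fourier {f : V → ℂ} (h1 : Integrable f) (h2 : MemLp f 2) :
    eLpNorm (𝓕 f) 2 volume = eLpNorm f 2 volume := by
  rw [← eLpNorm_congr_ae (Lp_fourier_ae_eq h1 h2), ← eLpNorm_congr_ae h2.coeFn_toLp]
  have := Lp.norm_fourier_eq (h2.toLp f)
  rw [Lp.norm_def, Lp.norm_def] at this
  exact (ENNReal.toReal_eq_toReal_iff' (Lp.eLpNorm_ne_top _) (Lp.eLpNorm_ne_top _)).1 this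

end Plancherel

/-! ### The scalar Fourier-Laplace transform and its Cauchy-Riemann equations. -/

section LaplaceFourier

variable {V : Type*} [NormedAddCommGroup V] [InnerProductSpace ℝ V] [FiniteDimensional ℝ V]
  [MeasurableSpace V] [BorelSpace V]

/-- The linear form `(a, b) ↦ 2π (⟪x, b⟫ - i ⟪x, a⟫)`. -/
def phase (x : V) : V × V →L[ℝ] ℂ :=
  (2 * Real.pi : ℂ) • (Complex.ofRealCLM.comp ((innerSL ℝ x).comp (ContinuousLinearMap.snd ℝ V V)) -
    I • Complex.ofRealCLM.comp ((innerSL ℝ x).comp (ContinuousLinearMap.fst ℝ V V)))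

theorem phase_apply (x : V) (p : V × V) :
    phase x p = 2 * Real.pi * ((⟪x, p.2⟫ : ℝ) - I * (⟪x, p.1⟫ : ℝ)) := by
  simp [phase]

theorem phase_continuous : Continuous (phase : V → V × V →L[ℝ] ℂ) := by
  unfold phase
  have h : Continuous fun x : V => innerSL ℝ x := (innerSL ℝ).continuous
  fun_prop

theorem norm_phase_le (x : V) : ‖phase x‖ ≤ 4 * Real.pi * ‖x‖ := by
  refine ContinuousLinearMap.opNorm_le_bound _ (by positivity) fun p => ?_
  rw [phase_apply, norm_mul]
  have h1 : ‖(2 * Real.pi : ℂ)‖ = 2 * Real.pi := by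
    simp [abs_of_pos Real.pi_pos]
  have h2 : ‖((⟪x, p.2⟫ : ℝ) : ℂ) - I * (⟪x, p.1⟫ : ℝ)‖ ≤ ‖x‖ * ‖p‖ + ‖x‖ * ‖p‖ := by
    refine (norm_sub_le _ _).trans (add_le_add ?_ ?_)
    · rw [Complex.norm_real]
      exact (norm_inner_le_norm _ _).trans (by gcongr; exact norm_snd_le p)
    · rw [norm_mul, norm_I, one_mul, Complex.norm_real]
      exact (norm_inner_le_norm _ _).trans (by gcongr; exact norm_fst_le p)
  rw [h1]
  nlinarith [Real.pi_pos]

theorem re_phase (x : V) (p : V × V) : (phase x p).re = 2 * Real.pi * ⟪x, p.2⟫ := by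
  simp [phase_apply]

/-- `(ξ, η) ↦ ∫ e^{2π⟪x, η⟫ - 2πi⟪x, ξ⟫} F(x) dx`. -/
def laplaceFourier (F : V → ℂ) (p : V × V) : ℂ := ∫ x, cexp (phase x p) * F x

/-- Exponential integrability of `F` near the weight `e^{2π⟪x, η⟫}`. -/
def ExpIntegrable (F : V → ℂ) (η : V) : Prop :=
  ∃ ε > 0, Integrable fun x => (Real.exp (2 * Real.pi * ⟪x, η⟫ + ε * ‖x‖) : ℂ) * F x

theorem ExpIntegrable.aestronglyMeasurable {F : V → ℂ} {η : V} (h : ExpIntegrable F η) :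
    AEStronglyMeasurable F volume := by
  obtain ⟨ε, -, h⟩ := h
  have hc : Continuous fun x : V => ((Real.exp (-(2 * Real.pi * ⟪x, η⟫ + ε * ‖x‖)) : ℝ) : ℂ) := by
    fun_prop
  refine (hc.aestronglyMeasurable.mul h.aestronglyMeasurable).congr (ae_of_all _ fun x => ?_)
  simp only [Pi.mul_apply]
  rw [← mul_assoc, ← Complex.ofReal_mul, ← Real.exp_add]
  simp

/-- The bound is asked for every `ε` because the margin supplied by `ExpIntegrable` is not known in
advance. -/
theorem ExpIntegrable.integrable_of_bound {F : V → ℂ} {η : V} (h : ExpIntegrable F η)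
    {W : Type*} [NormedAddCommGroup W] {u : V → W} (hu : AEStronglyMeasurable u volume)
    (hb : ∀ ε > 0, ∃ c, ∀ x, ‖u x‖ ≤ c * Real.exp (2 * Real.pi * ⟪x, η⟫ + ε * ‖x‖) * ‖F x‖) :
    Integrable u := by
  obtain ⟨ε, hε, h⟩ := h
  obtain ⟨c, hc⟩ := hb ε hε
  refine (h.norm.const_mul c).mono' hu (ae_of_all _ fun x => (hc x).trans (le_of_eq ?_))
  rw [norm_mul, Complex.norm_real, Real.norm_of_nonneg (Real.exp_pos _).le, mul_assoc]

theorem norm_cexp_phase (x : V) (p : V × V) :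
    ‖cexp (phase x p)‖ = Real.exp (2 * Real.pi * ⟪x, p.2⟫) := by
  rw [Complex.norm_exp, re_phase]

theorem ExpIntegrable.integrable {F : V → ℂ} {p : V × V} (h : ExpIntegrable F p.2) :
    Integrable fun x => cexp (phase x p) * F x := by
  have hc : Continuous fun x : V => cexp (phase x p) := by
    have := phase_continuous (V := V)
    fun_prop
  refine h.integrable_of_bound (hc.aestronglyMeasurable.mul h.aestronglyMeasurable)
    fun ε hε => ⟨1, fun x => ?_⟩
  rw [norm_mul, norm_cexp_phase, one_mul]
  gcongr
  have : 0 ≤ ε * ‖x‖ := by positivity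
  linarith

theorem le_exp_mul {ε : ℝ} (hε : 0 < ε) (t : ℝ) : t ≤ ε⁻¹ * Real.exp (ε * t) := by
  rw [le_inv_mul_iff₀ hε]
  linarith [Real.add_one_le_exp (ε * t)]

/-- Half of the margin pays for the linear growth of `phase x q`. Directional derivatives of
`laplaceFourier` are therefore again transforms of the same kind, which yields `C¹`. -/
theorem ExpIntegrable.phase_mul {F : V → ℂ} {η : V} (h : ExpIntegrable F η) (q : V × V) :
    ExpIntegrable (fun x => phase x q * F x) η := by
  obtain ⟨ε, hε, h'⟩ := id h
  have hm := h.aestronglyMeasurable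
  refine ⟨ε / 2, half_pos hε, ?_⟩
  have hp : Continuous fun x : V => phase x q := by
    have := phase_continuous (V := V)
    fun_prop
  have hc : Continuous fun x : V => ((Real.exp (2 * Real.pi * ⟪x, η⟫ + ε / 2 * ‖x‖) : ℝ) : ℂ) := by
    fun_prop
  refine (h'.norm.const_mul (4 * Real.pi * (ε / 2)⁻¹ * ‖q‖)).mono'
    (hc.aestronglyMeasurable.mul (hp.aestronglyMeasurable.mul hm)) (ae_of_all _ fun x => ?_)
  simp only [norm_mul, Complex.norm_real, Real.norm_of_nonneg (Real.exp_pos _).le]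
  have h1 : ‖phase x q‖ ≤ 4 * Real.pi * ((ε / 2)⁻¹ * Real.exp (ε / 2 * ‖x‖)) * ‖q‖ := by
    refine ((phase x).le_opNorm q).trans ?_
    gcongr
    refine (norm_phase_le x).trans ?_
    gcongr
    exact le_exp_mul (half_pos hε) _
  have h2 : Real.exp (2 * Real.pi * ⟪x, η⟫ + ε * ‖x‖) =
      Real.exp (2 * Real.pi * ⟪x, η⟫ + ε / 2 * ‖x‖) * Real.exp (ε / 2 * ‖x‖) := by
    rw [← Real.exp_add]; ring_nf
  rw [h2]
  calc _ ≤ Real.exp (2 * Real.pi * ⟪x, η⟫ + ε / 2 * ‖x‖) *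
        (4 * Real.pi * ((ε / 2)⁻¹ * Real.exp (ε / 2 * ‖x‖)) * ‖q‖ * ‖F x‖) := by gcongr
    _ = _ := by ring

theorem hasFDerivAt_laplaceFourier {F : V → ℂ} {p : V × V} (h : ExpIntegrable F p.2) :
    HasFDerivAt (laplaceFourier F) (∫ x, (cexp (phase x p) * F x) • phase x) p := by
  obtain ⟨ε, hε, h'⟩ := id h
  have hm := h.aestronglyMeasurable
  have hpc := phase_continuous (V := V)
  have hpi := Real.pi_pos
  -- Moving `η` by at most `δ` changes the exponent by at most `2πδ‖x‖ = (ε/2)‖x‖`; the other half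
  -- of the margin absorbs `‖phase x‖`.
  let δ : ℝ := ε / (4 * Real.pi)
  have hδ : 0 < δ := by positivity
  refine hasFDerivAt_integral_of_dominated_of_fderiv_le (Metric.ball_mem_nhds p hδ)
    (bound := fun x => 4 * Real.pi * (ε / 2)⁻¹ *
      ‖(Real.exp (2 * Real.pi * ⟪x, p.2⟫ + ε * ‖x‖) : ℂ) * F x‖)
    (F' := fun p x => (cexp (phase x p) * F x) • phase x) ?_ h.integrable ?_ ?_ ?_ ?_
  · refine Filter.Eventually.of_forall fun q => ?_
    have hc : Continuous fun x : V => cexp (phase x q) := by fun_prop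
    exact hc.aestronglyMeasurable.mul hm
  · have hc : Continuous fun x : V => cexp (phase x p) := by fun_prop
    exact (hc.aestronglyMeasurable.mul hm).smul hpc.aestronglyMeasurable
  · refine ae_of_all _ fun x q hq => ?_
    have hq2 : ‖q.2 - p.2‖ ≤ δ := by
      have : ‖q - p‖ < δ := by simpa [dist_eq_norm] using hq
      exact (norm_snd_le (q - p)).trans this.le
    rw [norm_smul, norm_mul, norm_mul, Complex.norm_real,
      Real.norm_of_nonneg (Real.exp_pos _).le, norm_cexp_phase]
    have h1 : 2 * Real.pi * ⟪x, q.2⟫ ≤ 2 * Real.pi * ⟪x, p.2⟫ + ε / 2 * ‖x‖ := by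
      have h3 : ⟪x, q.2 - p.2⟫ ≤ ‖x‖ * δ :=
        (real_inner_le_norm _ _).trans (by gcongr)
      rw [inner_sub_right] at h3
      have h4 : 2 * Real.pi * (‖x‖ * δ) = ε / 2 * ‖x‖ := by
        simp only [δ]; field_simp; ring
      nlinarith
    have h2 : Real.exp (2 * Real.pi * ⟪x, p.2⟫ + ε * ‖x‖) =
        Real.exp (2 * Real.pi * ⟪x, p.2⟫ + ε / 2 * ‖x‖) * Real.exp (ε / 2 * ‖x‖) := by
      rw [← Real.exp_add]; ring_nf
    rw [h2]
    calc _ ≤ Real.exp (2 * Real.pi * ⟪x, p.2⟫ + ε / 2 * ‖x‖) * ‖F x‖ *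
          (4 * Real.pi * ((ε / 2)⁻¹ * Real.exp (ε / 2 * ‖x‖))) := by
          gcongr
          refine (norm_phase_le x).trans ?_
          gcongr
          exact le_exp_mul (half_pos hε) _
      _ = _ := by ring
  · exact h'.norm.const_mul _
  · refine ae_of_all _ fun x q _ => ?_
    have := ((phase x).hasFDerivAt (x := q)).cexp.mul_const (F x)
    convert! this using 1
    refine ContinuousLinearMap.ext fun a => ?_
    simp
    ring

theorem fderiv_laplaceFourier {F : V → ℂ} {p : V × V} (h : ExpIntegrable F p.2) (q : V × V) :
    fderiv ℝ (laplaceFourier F) p q = laplaceFourier (fun x => phase x q * F x) p := by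
  rw [(hasFDerivAt_laplaceFourier h).fderiv]
  have hm := h.aestronglyMeasurable
  have hpc := phase_continuous (V := V)
  rw [ContinuousLinearMap.integral_apply]
  · refine integral_congr_ae (ae_of_all _ fun x => ?_)
    simp
    ring
  · have hc : Continuous fun x : V => cexp (phase x p) := by fun_prop
    refine h.integrable_of_bound
      ((hc.aestronglyMeasurable.mul hm).smul hpc.aestronglyMeasurable) fun ε hε =>
        ⟨4 * Real.pi * ε⁻¹, fun x => ?_⟩
    rw [norm_smul, norm_mul, norm_cexp_phase, Real.exp_add]
    calc _ ≤ Real.exp (2 * Real.pi * ⟪x, p.2⟫) * ‖F x‖ *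
          (4 * Real.pi * (ε⁻¹ * Real.exp (ε * ‖x‖))) := by
          gcongr
          refine (norm_phase_le x).trans ?_
          gcongr
          exact le_exp_mul hε _
      _ = _ := by ring

theorem contDiffOn_laplaceFourier {F : V → ℂ} {Ω : Set V} (hΩ : IsOpen Ω)
    (h : ∀ η ∈ Ω, ExpIntegrable F η) :
    ContDiffOn ℝ 1 (laplaceFourier F) {p : V × V | p.2 ∈ Ω} := by
  have hO : IsOpen {p : V × V | p.2 ∈ Ω} := hΩ.preimage continuous_snd
  rw [← zero_add (1 : WithTop ℕ∞), contDiffOn_succ_iff_fderiv_of_isOpen hO, contDiffOn_zero]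
  refine ⟨fun p hp => (hasFDerivAt_laplaceFourier (h _ hp)).differentiableAt.differentiableWithinAt,
    by simp, continuousOn_clm_apply.2 fun q => ?_⟩
  refine ContinuousOn.congr (f := laplaceFourier (fun x => phase x q * F x)) ?_
    fun p hp => fderiv_laplaceFourier (h _ hp) q
  exact fun p hp => (hasFDerivAt_laplaceFourier
    ((h _ hp).phase_mul q)).continuousAt.continuousWithinAt

/-- The phase is `-2πi⟪x, ξ + iη⟫`, complex linear in `ξ + iη`. -/
theorem fderiv_laplaceFourier_snd {F : V → ℂ} {p : V × V} (h : ExpIntegrable F p.2) (b : V) :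
    fderiv ℝ (laplaceFourier F) p (0, b) = I * fderiv ℝ (laplaceFourier F) p (b, 0) := by
  rw [fderiv_laplaceFourier h, fderiv_laplaceFourier h, laplaceFourier, laplaceFourier,
    ← integral_const_mul]
  refine integral_congr_ae (ae_of_all _ fun x => ?_)
  simp only [phase_apply, inner_zero_right, ofReal_zero, mul_zero, sub_zero, zero_sub]
  linear_combination (2 * Real.pi * cexp (2 * Real.pi * (⟪x, p.2⟫ - I * ⟪x, p.1⟫)) *
    ⟪x, b⟫ * F x : ℂ) * I_mul_I

theorem laplaceFourier_eq_fourier (F : V → ℂ) (ξ η : V) :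
    laplaceFourier F (ξ, η) = 𝓕 (fun x => (Real.exp (2 * Real.pi * ⟪x, η⟫) : ℂ) * F x) ξ := by
  rw [Real.fourier_eq', laplaceFourier]
  refine integral_congr_ae (ae_of_all _ fun x => ?_)
  simp only [phase_apply, smul_eq_mul]
  rw [← mul_assoc, ofReal_exp, ← Complex.exp_add]
  congr 2
  push_cast
  ring

end LaplaceFourier

/-! ### Shifting the contour in a tube. -/

section ContourShift

variable {V : Type*} [NormedAddCommGroup V] [InnerProductSpace ℝ V] [FiniteDimensional ℝ V]
  [MeasurableSpace V] [BorelSpace V]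

/-- `Q` is of class `C¹` and satisfies the Cauchy-Riemann equations
`∂Q/∂η = i ∂Q/∂ξ` in the tube `{(ξ, η) | η ∈ Ω}`. -/
def HolomorphicOnTube (Q : V × V → ℂ) (Ω : Set V) : Prop :=
  ContDiffOn ℝ 1 Q {p | p.2 ∈ Ω} ∧
    ∀ p : V × V, p.2 ∈ Ω → ∀ b : V, fderiv ℝ Q p (0, b) = I * fderiv ℝ Q p (b, 0)

theorem isOpen_tube {Ω : Set V} (hΩ : IsOpen Ω) : IsOpen {p : V × V | p.2 ∈ Ω} :=
  hΩ.preimage continuous_snd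

theorem HolomorphicOnTube.differentiableAt {Q : V × V → ℂ} {Ω : Set V} (hQ : HolomorphicOnTube Q Ω)
    (hΩ : IsOpen Ω) {p : V × V} (hp : p.2 ∈ Ω) : DifferentiableAt ℝ Q p :=
  (hQ.1.differentiableOn (by norm_num)).differentiableAt ((isOpen_tube hΩ).mem_nhds hp)

theorem HolomorphicOnTube.mul {Q K : V × V → ℂ} {Ω : Set V} (hΩ : IsOpen Ω)
    (hQ : HolomorphicOnTube Q Ω) (hK : HolomorphicOnTube K Ω) :
    HolomorphicOnTube (fun p => Q p * K p) Ω := by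
  refine ⟨hQ.1.mul hK.1, fun p hp b => ?_⟩
  rw [fderiv_fun_mul (hQ.differentiableAt hΩ hp) (hK.differentiableAt hΩ hp)]
  simp only [_root_.add_apply, _root_.smul_apply, smul_eq_mul,
    hQ.2 p hp, hK.2 p hp]
  ring

theorem HolomorphicOnTube.continuous_slice {Q : V × V → ℂ} {Ω : Set V}
    (hQ : HolomorphicOnTube Q Ω) {η : V} (hη : η ∈ Ω) : Continuous fun ξ => Q (ξ, η) :=
  hQ.1.continuousOn.comp_continuous (by fun_prop) fun _ => hη

theorem HolomorphicOnTube.continuousOn_fderiv {Q : V × V → ℂ} {Ω : Set V}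
    (hQ : HolomorphicOnTube Q Ω) (hΩ : IsOpen Ω) :
    ContinuousOn (fderiv ℝ Q) {p : V × V | p.2 ∈ Ω} :=
  hQ.1.continuousOn_fderiv_of_isOpen (isOpen_tube hΩ) le_rfl

/-- Cauchy-Riemann trades the `η`-derivative for `i` times a `ξ`-derivative, and integration by
parts moves the latter onto the cutoff. -/
theorem hasDerivAt_integral_cutoff {Q : V × V → ℂ} {Ω : Set V} (hQ : HolomorphicOnTube Q Ω)
    (hΩ : IsOpen Ω) {χ : V → ℝ} (hχ : ContDiff ℝ ∞ χ) (hχs : HasCompactSupport χ) (a b : V)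
    {t : ℝ} (ht : a + t • b ∈ Ω) :
    HasDerivAt (fun t : ℝ => ∫ ξ, χ ξ • Q (ξ, a + t • b))
      (-I * ∫ ξ, fderiv ℝ χ ξ b • Q (ξ, a + t • b)) t := by
  have hγ : Continuous fun t : ℝ => a + t • b := by fun_prop
  obtain ⟨δ, hδ, hball⟩ := Metric.nhds_basis_closedBall.mem_iff.1
    ((hΩ.preimage hγ).mem_nhds (x := t) ht)
  have hcD : ContinuousOn (fun q : V × ℝ => fderiv ℝ Q (q.1, a + q.2 • b) (0, b))
      (tsupport χ ×ˢ Metric.closedBall t δ) := by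
    have h1 : ContinuousOn (fun q : V × ℝ => fderiv ℝ Q (q.1, a + q.2 • b))
        (tsupport χ ×ˢ Metric.closedBall t δ) :=
      (hQ.continuousOn_fderiv hΩ).comp (by fun_prop) fun q hq => hball hq.2
    exact h1.clm_apply continuousOn_const
  obtain ⟨C, hC⟩ := (hχs.isCompact.prod (isCompact_closedBall t δ)).exists_bound_of_continuousOn hcD
  have hQd : ∀ ξ, ∀ s ∈ Metric.ball t δ, HasDerivAt (fun s : ℝ => Q (ξ, a + s • b))
      (fderiv ℝ Q (ξ, a + s • b) (0, b)) s := by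
    intro ξ s hs
    have h1 : HasFDerivAt Q (fderiv ℝ Q (ξ, a + s • b)) (ξ, a + s • b) :=
      (hQ.differentiableAt hΩ (p := (ξ, a + s • b))
        (hball (Metric.ball_subset_closedBall hs))).hasFDerivAt
    have h2 : HasDerivAt (fun s : ℝ => (ξ, a + s • b)) (0, b) s := by
      refine (hasDerivAt_const s ξ).prodMk ?_
      simpa using ((hasDerivAt_id s).smul_const b).const_add a
    exact h1.comp_hasDerivAt s h2
  have hcs : ∀ s ∈ Metric.ball t δ, Continuous fun ξ => χ ξ • Q (ξ, a + s • b) := fun s hs =>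
    hχ.continuous.smul (hQ.continuous_slice (hball (Metric.ball_subset_closedBall hs)))
  have htb : t ∈ Metric.ball t δ := Metric.mem_ball_self hδ
  have hdc : Continuous fun ξ => fderiv ℝ Q (ξ, a + t • b) :=
    (hQ.continuousOn_fderiv hΩ).comp_continuous (by fun_prop) fun _ => ht
  have hcs' : ∀ v : V × V, Continuous fun ξ => χ ξ • fderiv ℝ Q (ξ, a + t • b) v := fun v =>
    hχ.continuous.smul (hdc.clm_apply continuous_const)
  have main := hasDerivAt_integral_of_dominated_loc_of_deriv_le (μ := volume)
    (F := fun (s : ℝ) ξ => χ ξ • Q (ξ, a + s • b))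
    (F' := fun s ξ => χ ξ • fderiv ℝ Q (ξ, a + s • b) (0, b)) (x₀ := t)
    (bound := fun ξ => C * ‖χ ξ‖) (Metric.ball_mem_nhds t hδ)
    (Filter.eventually_of_mem (Metric.ball_mem_nhds t hδ)
      fun s hs => (hcs s hs).aestronglyMeasurable)
    ((hcs t htb).integrable_of_hasCompactSupport hχs.smul_right)
    (hcs' _).aestronglyMeasurable
    (ae_of_all _ fun ξ s hs => by
      by_cases hξ : ξ ∈ tsupport χ
      · rw [norm_smul, mul_comm]
        gcongr
        exact hC (ξ, s) ⟨hξ, Metric.ball_subset_closedBall hs⟩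
      · simp [image_eq_zero_of_notMem_tsupport hξ])
    ((hχ.continuous.norm.integrable_of_hasCompactSupport hχs.norm).const_mul C)
    (ae_of_all _ fun ξ s hs => (hQd ξ s hs).const_smul (χ ξ))
  have hg : ∀ ξ, HasFDerivAt (fun ξ => Q (ξ, a + t • b))
      ((fderiv ℝ Q (ξ, a + t • b)).comp (ContinuousLinearMap.inl ℝ V V)) ξ := fun ξ =>
    ((hQ.differentiableAt hΩ (p := (ξ, a + t • b)) ht).hasFDerivAt).comp ξ
      (hasFDerivAt_prodMk_left ξ (a + t • b))
  have hg' : ∀ ξ, fderiv ℝ (fun ξ => Q (ξ, a + t • b)) ξ b = fderiv ℝ Q (ξ, a + t • b) (b, 0) :=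
    fun ξ => by rw [(hg ξ).fderiv]; simp
  have hχd : Continuous fun ξ => fderiv ℝ χ ξ b :=
    (hχ.continuous_fderiv (by simp)).clm_apply continuous_const
  have hχds : HasCompactSupport fun ξ => fderiv ℝ χ ξ b := hχs.fderiv_apply ℝ b
  have ibp := integral_smul_fderiv_eq_neg_fderiv_smul_of_integrable (μ := (volume : Measure V))
    (f := χ) (g := fun ξ => Q (ξ, a + t • b)) (v := b) (𝕜 := ℝ)
    ((hχd.smul (hQ.continuous_slice ht)).integrable_of_hasCompactSupport hχds.smul_right)
    (by simp only [hg']; exact (hcs' _).integrable_of_hasCompactSupport hχs.smul_right)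
    ((hcs t htb).integrable_of_hasCompactSupport hχs.smul_right)
    (fun ξ _ => (hχ.differentiable (by simp)) ξ) (fun ξ _ => (hg ξ).differentiableAt)
  simp only [hg'] at ibp
  have hI : -I * ∫ ξ, fderiv ℝ χ ξ b • Q (ξ, a + t • b) =
      ∫ ξ, χ ξ • fderiv ℝ Q (ξ, a + t • b) (0, b) := by
    rw [neg_mul, ← mul_neg, ← ibp, ← integral_const_mul]
    refine integral_congr_ae (ae_of_all _ fun ξ => ?_)
    simp only [hQ.2 (ξ, a + t • b) ht b, mul_smul_comm]
  rw [hI]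
  exact main.2

/-- With the cutoff `χ(ξ/R)` the derivative along the segment is `O(1/R)` times the uniform `L¹`
bound `M`, and it disappears as `R → ∞`. No pointwise decay of `Q` is needed. -/
theorem integral_slice_eq {Q : V × V → ℂ} {Ω : Set V} (hQ : HolomorphicOnTube Q Ω)
    (hΩ : IsOpen Ω) (hconv : Convex ℝ Ω) {η₀ η₁ : V} (h₀ : η₀ ∈ Ω) (h₁ : η₁ ∈ Ω) {M : ℝ}
    (hint : ∀ η ∈ segment ℝ η₀ η₁, Integrable fun ξ => Q (ξ, η))
    (hM : ∀ η ∈ segment ℝ η₀ η₁, ∫ ξ, ‖Q (ξ, η)‖ ≤ M) :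
    ∫ ξ, Q (ξ, η₀) = ∫ ξ, Q (ξ, η₁) := by
  let χ : ContDiffBump (0 : V) := ⟨1, 2, one_pos, one_lt_two⟩
  have hχ : ContDiff ℝ ∞ χ := χ.contDiff
  have hχs : HasCompactSupport χ := χ.hasCompactSupport
  obtain ⟨L, hL⟩ := (hχs.fderiv ℝ).exists_bound_of_continuous (hχ.continuous_fderiv (by simp))
  have hseg : ∀ t ∈ Set.Icc (0 : ℝ) 1, η₀ + t • (η₁ - η₀) ∈ segment ℝ η₀ η₁ := fun t ht => by
    rw [segment_eq_image']
    exact ⟨t, ht, rfl⟩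
  have hsub : segment ℝ η₀ η₁ ⊆ Ω := hconv.segment_subset h₀ h₁
  have key : ∀ R : ℝ, 0 < R →
      ‖(∫ ξ, χ (R⁻¹ • ξ) • Q (ξ, η₁)) - ∫ ξ, χ (R⁻¹ • ξ) • Q (ξ, η₀)‖ ≤
        R⁻¹ * L * ‖η₁ - η₀‖ * M := by
    intro R hR
    have hR' : R⁻¹ ≠ 0 := (inv_pos.2 hR).ne'
    have hψ : ContDiff ℝ ∞ fun ξ => χ (R⁻¹ • ξ) := hχ.comp (contDiff_const_smul R⁻¹)
    have hψs : HasCompactSupport fun ξ => χ (R⁻¹ • ξ) :=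
      hχs.comp_homeomorph (Homeomorph.smulOfNeZero R⁻¹ hR')
    have hψd : ∀ ξ, ‖fderiv ℝ (fun ξ => χ (R⁻¹ • ξ)) ξ (η₁ - η₀)‖ ≤ R⁻¹ * L * ‖η₁ - η₀‖ := by
      intro ξ
      refine (ContinuousLinearMap.le_opNorm _ _).trans ?_
      gcongr
      rw [fderiv_comp_smul, norm_smul, Real.norm_of_nonneg (inv_pos.2 hR).le]
      gcongr
      exact hL _
    have hd := fun t (ht : t ∈ Set.Icc (0 : ℝ) 1) =>
      (hasDerivAt_integral_cutoff hQ hΩ hψ hψs η₀ (η₁ - η₀) (hsub (hseg t ht))).hasDerivWithinAt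
        (s := Set.Icc 0 1)
    have := norm_image_sub_le_of_norm_deriv_le_segment_01' (C := R⁻¹ * L * ‖η₁ - η₀‖ * M) hd ?_
    · simpa using this
    · intro t ht
      have ht' := hseg t (Set.Ico_subset_Icc_self ht)
      rw [norm_mul, norm_neg, norm_I, one_mul]
      refine (norm_integral_le_integral_norm _).trans ?_
      have hL0 : 0 ≤ R⁻¹ * L * ‖η₁ - η₀‖ := (norm_nonneg _).trans (hψd 0)
      calc _ ≤ ∫ ξ, R⁻¹ * L * ‖η₁ - η₀‖ * ‖Q (ξ, η₀ + t • (η₁ - η₀))‖ := by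
            refine integral_mono_of_nonneg (ae_of_all _ fun _ => norm_nonneg _)
              ((hint _ ht').norm.const_mul _) (ae_of_all _ fun ξ => ?_)
            simp only [norm_smul]
            gcongr
            exact hψd ξ
        _ ≤ _ := by
            rw [integral_const_mul]
            gcongr
            exact hM _ ht'
  have lim : ∀ η ∈ segment ℝ η₀ η₁, Filter.Tendsto
      (fun N : ℕ => ∫ ξ, χ (((N : ℝ) + 1)⁻¹ • ξ) • Q (ξ, η)) Filter.atTop
      (𝓝 (∫ ξ, Q (ξ, η))) := by
    intro η hη
    refine tendsto_integral_of_dominated_convergence (fun ξ => ‖Q (ξ, η)‖) (fun N => ?_)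
      (hint η hη).norm (fun N => ae_of_all _ fun ξ => ?_) (ae_of_all _ fun ξ => ?_)
    · have h : Continuous fun ξ : V => χ (((N : ℝ) + 1)⁻¹ • ξ) :=
        χ.continuous.comp (continuous_const_smul _)
      exact h.aestronglyMeasurable.smul (hint η hη).aestronglyMeasurable
    · rw [norm_smul, Real.norm_of_nonneg χ.nonneg]
      exact mul_le_of_le_one_left (norm_nonneg _) χ.le_one
    -- For fixed `ξ` the cutoff equals `1` as soon as `N ≥ ‖ξ‖`.
    · refine tendsto_const_nhds.congr' ?_
      filter_upwards [Filter.eventually_ge_atTop ⌈‖ξ‖⌉₊] with N hN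
      rw [χ.one_of_mem_closedBall, one_smul]
      rw [mem_closedBall_zero_iff, norm_smul, norm_inv,
        Real.norm_of_nonneg (by positivity : (0 : ℝ) ≤ N + 1)]
      have : ‖ξ‖ ≤ N := (Nat.le_ceil _).trans (by exact_mod_cast hN)
      change _ ≤ (1 : ℝ)
      rw [inv_mul_le_iff₀ (by positivity)]
      linarith
  have h0 : Filter.Tendsto (fun N : ℕ => ((N : ℝ) + 1)⁻¹ * L * ‖η₁ - η₀‖ * M) Filter.atTop
      (𝓝 0) := by
    have h1 : Filter.Tendsto (fun N : ℕ => ((N : ℝ) + 1)⁻¹) Filter.atTop (𝓝 0) := by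
      simpa using tendsto_one_div_add_atTop_nhds_zero_nat (𝕜 := ℝ)
    simpa using ((h1.mul_const L).mul_const ‖η₁ - η₀‖).mul_const M
  have h2 := ((lim η₁ (right_mem_segment ℝ _ _)).sub (lim η₀ (left_mem_segment ℝ _ _))).norm
  have h3 := le_of_tendsto_of_tendsto' h2 h0 fun N => key _ (by positivity)
  exact (sub_eq_zero.1 (norm_le_zero_iff.1 h3)).symm

end ContourShift

/-! ### Recovering the spectral function from the slices of a holomorphic function. -/

section TubeTransform

variable {V : Type*} [NormedAddCommGroup V] [InnerProductSpace ℝ V] [FiniteDimensional ℝ V]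
  [MeasurableSpace V] [BorelSpace V]

theorem expIntegrable_of_hasCompactSupport {φ : V → ℂ} (hc : Continuous φ)
    (hs : HasCompactSupport φ) (η : V) : ExpIntegrable φ η := by
  refine ⟨1, one_pos, ?_⟩
  have h : Continuous fun x : V => (Real.exp (2 * Real.pi * ⟪x, η⟫ + 1 * ‖x‖) : ℂ) * φ x := by
    fun_prop
  exact h.integrable_of_hasCompactSupport hs.mul_left

theorem holomorphicOnTube_laplaceFourier {F : V → ℂ} {Ω : Set V} (hΩ : IsOpen Ω)
    (h : ∀ η ∈ Ω, ExpIntegrable F η) : HolomorphicOnTube (laplaceFourier F) Ω :=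
  ⟨contDiffOn_laplaceFourier hΩ h, fun _ hp b => fderiv_laplaceFourier_snd (h _ hp) b⟩

/-- Multiplication by the weight `e^{2π⟪x, η⟫}`. -/
def expMul (η : V) (F : V → ℂ) (x : V) : ℂ := (Real.exp (2 * Real.pi * ⟪x, η⟫) : ℂ) * F x

theorem expMul_expMul (η ζ : V) (F : V → ℂ) : expMul η (expMul ζ F) = expMul (η + ζ) F := by
  ext x
  simp only [expMul]
  rw [← mul_assoc, ← Complex.ofReal_mul, ← Real.exp_add, inner_add_right, mul_add]

theorem expMul_zero (F : V → ℂ) : expMul 0 F = F := by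
  ext x
  simp [expMul]

theorem continuous_expMul {F : V → ℂ} (hF : Continuous F) (η : V) : Continuous (expMul η F) := by
  unfold expMul
  fun_prop

theorem aestronglyMeasurable_expMul {μ : Measure V} {F : V → ℂ}
    (hF : AEStronglyMeasurable F μ) (η : V) : AEStronglyMeasurable (expMul η F) μ := by
  have h : Continuous fun x : V => (Real.exp (2 * Real.pi * ⟪x, η⟫) : ℂ) := by fun_prop
  exact h.aestronglyMeasurable.mul hF

theorem laplaceFourier_eq_fourier_expMul (F : V → ℂ) (ξ η : V) :
    laplaceFourier F (ξ, η) = 𝓕 (expMul η F) ξ :=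
  laplaceFourier_eq_fourier F ξ η

theorem ExpIntegrable.integrable_expMul {F : V → ℂ} {η : V} (h : ExpIntegrable F η) :
    Integrable (expMul η F) := by
  refine h.integrable_of_bound (aestronglyMeasurable_expMul h.aestronglyMeasurable η)
    fun ε hε => ⟨1, fun x => ?_⟩
  rw [expMul, norm_mul, Complex.norm_real, Real.norm_of_nonneg (Real.exp_pos _).le, one_mul]
  gcongr
  have : 0 ≤ ε * ‖x‖ := by positivity
  linarith

/-- The inverse Fourier transform of a slice, as an element of `L²`. -/
def sliceInv (H : V × V → ℂ) (η : V) (h : MemLp (fun ξ => H (ξ, η)) 2) :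
    Lp ℂ 2 (volume : Measure V) :=
  𝓕⁻ (h.toLp _)

/-- Duality moves the inverse transform onto the test function, whose Fourier-Laplace transform is
entire. The pairing becomes the integral of a holomorphic function over a slice, ready for
`integral_slice_eq`; the reflection comes from `𝓕⁻` being `𝓕` after `x ↦ -x`. -/
theorem integral_smul_expMul_sliceInv {H : V × V → ℂ} {η : V}
    (h : MemLp (fun ξ => H (ξ, η)) 2) {φ : V → ℂ} (hφ : ContDiff ℝ ∞ φ)
    (hφs : HasCompactSupport φ) :
    ∫ x, φ x * expMul (-η) (sliceInv H η h) x =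
      ∫ ξ, laplaceFourier (fun x => φ (-x)) (ξ, η) * H (ξ, η) := by
  have h1 : HasCompactSupport (expMul (-η) φ) := hφs.mul_left
  have h2 : ContDiff ℝ ∞ (expMul (-η) φ) := by
    have : ContDiff ℝ ∞ fun x : V => (Real.exp (2 * Real.pi * ⟪x, -η⟫) : ℂ) := by
      have h3 : ContDiff ℝ ∞ fun x : V => Real.exp (2 * Real.pi * ⟪x, -η⟫) :=
        (contDiff_const.mul (contDiff_id.inner ℝ contDiff_const)).exp
      exact Complex.ofRealCLM.contDiff.comp h3
    exact this.mul hφ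
  let ψ : 𝓢(V, ℂ) := h1.toSchwartzMap h2
  have hψ : (ψ : V → ℂ) = expMul (-η) φ := rfl
  have key := congrArg (fun T => T ψ) (Lp.fourierInv_toTemperedDistribution_eq (h.toLp _))
  simp only [TemperedDistribution.fourierInv_apply, Lp.toTemperedDistribution_apply] at key
  have h3 : ∫ x, φ x * expMul (-η) (sliceInv H η h) x = ∫ x, ψ x • sliceInv H η h x := by
    refine integral_congr_ae (ae_of_all _ fun x => ?_)
    simp only [hψ, expMul, smul_eq_mul]
    ring
  rw [h3, sliceInv, ← key]
  refine integral_congr_ae ?_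
  filter_upwards [h.coeFn_toLp] with ξ hξ
  rw [hξ, smul_eq_mul, laplaceFourier_eq_fourier_expMul, SchwartzMap.fourierInv_coe,
    Real.fourierInv_eq_fourier_comp_neg, hψ]
  have e : (fun x => expMul (-η) φ (-x)) = expMul η fun x => φ (-x) := by
    ext x
    simp [expMul]
  rw [e]

theorem integral_norm_mul_le {f g : V → ℂ} (hf : MemLp f 2) (hg : MemLp g 2) :
    Integrable (fun x => f x * g x) ∧
      ∫ x, ‖f x * g x‖ ≤ (eLpNorm f 2 volume * eLpNorm g 2 volume).toReal := by
  have h1 : Integrable (fun x => f x * g x) := MemLp.integrable_mul (p := 2) (q := 2) hf hg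
  refine ⟨h1, ?_⟩
  rw [integral_norm_eq_lintegral_enorm h1.aestronglyMeasurable, ← eLpNorm_one_eq_lintegral_enorm]
  have h2 : eLpNorm (f • g) 1 volume ≤ eLpNorm f 2 volume * eLpNorm g 2 volume :=
    eLpNorm_smul_le_mul_eLpNorm hg.1 hf.1
  exact ENNReal.toReal_mono (ENNReal.mul_ne_top hf.eLpNorm_ne_top hg.eLpNorm_ne_top) h2

theorem integral_smul_expMul_sliceInv_eq {H : V × V → ℂ} {Ω : Set V} (hΩ : IsOpen Ω)
    (hconv : Convex ℝ Ω) (hH : HolomorphicOnTube H Ω) {C : ℝ≥0}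
    (hL : ∀ η ∈ Ω, MemLp (fun ξ => H (ξ, η)) 2)
    (hC : ∀ η ∈ Ω, eLpNorm (fun ξ => H (ξ, η)) 2 volume ≤ C)
    {η₀ η₁ : V} (h₀ : η₀ ∈ Ω) (h₁ : η₁ ∈ Ω) {φ : V → ℂ} (hφ : ContDiff ℝ ∞ φ)
    (hφs : HasCompactSupport φ) :
    ∫ x, φ x * expMul (-η₀) (sliceInv H η₀ (hL _ h₀)) x =
      ∫ x, φ x * expMul (-η₁) (sliceInv H η₁ (hL _ h₁)) x := by
  rw [integral_smul_expMul_sliceInv _ hφ hφs, integral_smul_expMul_sliceInv _ hφ hφs]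
  have hc : Continuous fun x => φ (-x) := hφ.continuous.comp continuous_neg
  have hs : HasCompactSupport fun x => φ (-x) :=
    hφs.comp_homeomorph (Homeomorph.neg V)
  have hE : ∀ η, ExpIntegrable (fun x => φ (-x)) η := expIntegrable_of_hasCompactSupport hc hs
  have hK : HolomorphicOnTube (laplaceFourier fun x => φ (-x)) Ω :=
    holomorphicOnTube_laplaceFourier hΩ fun η _ => hE η
  have hsub : segment ℝ η₀ η₁ ⊆ Ω := hconv.segment_subset h₀ h₁
  have hmem : ∀ η, MemLp (expMul η fun x => φ (-x)) 2 := fun η =>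
    (continuous_expMul hc η).memLp_of_hasCompactSupport hs.mul_left
  have hslice : ∀ η, (fun ξ => laplaceFourier (fun x => φ (-x)) (ξ, η)) =
      𝓕 (expMul η fun x => φ (-x)) := fun η => funext fun ξ =>
    laplaceFourier_eq_fourier_expMul _ ξ η
  have hKL : ∀ η ∈ Ω, MemLp (fun ξ => laplaceFourier (fun x => φ (-x)) (ξ, η)) 2 := fun η hη => by
    refine ⟨(hK.continuous_slice hη).aestronglyMeasurable, ?_⟩
    rw [hslice, eLpNorm_fourier (hE η).integrable_expMul (hmem η)]
    exact (hmem η).2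
  -- `r` bounds `‖η‖` on the segment, so the single weight `w` dominates every `expMul η` of the
  -- reflected test function. Plancherel and Cauchy-Schwarz then give the uniform `L¹` bound.
  let r : ℝ := ‖η₀‖ + ‖η₁‖
  let w : V → ℂ := fun x => (Real.exp (2 * Real.pi * (‖x‖ * r)) : ℂ) * φ (-x)
  have hw : MemLp w 2 := by
    have : Continuous w := by fun_prop
    exact this.memLp_of_hasCompactSupport hs.mul_left
  have hKB : ∀ η ∈ segment ℝ η₀ η₁,
      eLpNorm (fun ξ => laplaceFourier (fun x => φ (-x)) (ξ, η)) 2 volume ≤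
        eLpNorm w 2 volume := by
    intro η hη
    rw [hslice, eLpNorm_fourier (hE η).integrable_expMul (hmem η)]
    refine eLpNorm_mono fun x => ?_
    have hr : ‖η‖ ≤ r := by
      obtain ⟨s, t, hs, ht, hst, rfl⟩ := hη
      refine (norm_add_le _ _).trans (add_le_add ?_ ?_) <;> rw [norm_smul, Real.norm_of_nonneg ‹_›]
      · exact mul_le_of_le_one_left (norm_nonneg _) (by linarith)
      · exact mul_le_of_le_one_left (norm_nonneg _) (by linarith)
    simp only [expMul, w, norm_mul, Complex.norm_real, Real.norm_of_nonneg (Real.exp_pos _).le]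
    gcongr
    exact (real_inner_le_norm _ _).trans (by gcongr)
  refine integral_slice_eq (hK.mul hΩ hH) hΩ hconv h₀ h₁
    (M := (eLpNorm w 2 volume * C).toReal) (fun η hη => ?_) fun η hη => ?_
  · exact (integral_norm_mul_le (hKL η (hsub hη)) (hL η (hsub hη))).1
  · refine (integral_norm_mul_le (hKL η (hsub hη)) (hL η (hsub hη))).2.trans ?_
    exact ENNReal.toReal_mono (ENNReal.mul_ne_top hw.eLpNorm_ne_top ENNReal.coe_ne_top)
      (mul_le_mul' (hKB η hη) (hC η (hsub hη)))

theorem locallyIntegrable_expMul {F : V → ℂ} (hF : LocallyIntegrable F) (η : V) :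
    LocallyIntegrable (expMul η F) := by
  have h : Continuous fun x : V => (Real.exp (2 * Real.pi * ⟪x, η⟫) : ℂ) := by fun_prop
  exact locallyIntegrableOn_univ.1
    (((locallyIntegrableOn_univ.2 hF).continuousOn_mul h.continuousOn isOpen_univ.isLocallyClosed))

/-- `F` is read off at an arbitrary base point `η₀`; agreement against all test functions shows that
any other `η` gives the same function almost everywhere. -/
theorem exists_expMul_eq_sliceInv {H : V × V → ℂ} {Ω : Set V} (hΩ : IsOpen Ω)
    (hconv : Convex ℝ Ω) (hne : Ω.Nonempty) (hH : HolomorphicOnTube H Ω) {C : ℝ≥0}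
    (hL : ∀ η ∈ Ω, MemLp (fun ξ => H (ξ, η)) 2)
    (hC : ∀ η ∈ Ω, eLpNorm (fun ξ => H (ξ, η)) 2 volume ≤ C) :
    ∃ F : V → ℂ, AEStronglyMeasurable F volume ∧ ∀ η (hη : η ∈ Ω),
      expMul η F =ᵐ[volume] sliceInv H η (hL η hη) := by
  obtain ⟨η₀, h₀⟩ := hne
  refine ⟨expMul (-η₀) (sliceInv H η₀ (hL _ h₀)),
    aestronglyMeasurable_expMul (Lp.aestronglyMeasurable _) _, fun η hη => ?_⟩
  have hli : ∀ η' (hη' : η' ∈ Ω),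
      LocallyIntegrable (expMul (-η') (sliceInv H η' (hL _ hη'))) := fun η' hη' =>
    locallyIntegrable_expMul ((Lp.memLp _).locallyIntegrable (by norm_num)) _
  have h := ae_eq_of_integral_contDiff_smul_eq (hli η₀ h₀) (hli η hη) fun g hg hgs =>
    integral_smul_expMul_sliceInv_eq hΩ hconv hH hL hC h₀ hη
      (φ := Complex.ofRealCLM ∘ g) (by fun_prop) (hgs.comp_left rfl)
  filter_upwards [h] with x hx
  have e := congrFun (expMul_expMul η (-η) (sliceInv H η (hL _ hη))) x
  rw [add_neg_cancel, expMul_zero] at e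
  rw [← e]
  simp only [expMul] at hx ⊢
  rw [hx]

theorem eLpNorm_sliceInv {H : V × V → ℂ} {η : V} (h : MemLp (fun ξ => H (ξ, η)) 2) :
    eLpNorm (sliceInv H η h) 2 volume = eLpNorm (fun ξ => H (ξ, η)) 2 volume := by
  have h1 : ‖sliceInv H η h‖ = ‖h.toLp _‖ := (Lp.fourierTransformₗᵢ V ℂ).symm.norm_map _
  rw [Lp.norm_def, Lp.norm_def, eLpNorm_congr_ae h.coeFn_toLp] at h1
  exact (ENNReal.toReal_eq_toReal_iff' (Lp.eLpNorm_ne_top _) h.eLpNorm_ne_top).1 h1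

/-- Fourier inversion gives equality almost everywhere on the slice, and continuity of both sides
removes the exceptional set. -/
theorem eq_laplaceFourier_of_expMul_eq_sliceInv {H : V × V → ℂ} {Ω : Set V} (hΩ : IsOpen Ω)
    (hH : HolomorphicOnTube H Ω) {F : V → ℂ} (hF : ∀ η ∈ Ω, ExpIntegrable F η) {η : V}
    (hη : η ∈ Ω) (h : MemLp (fun ξ => H (ξ, η)) 2)
    (hFH : expMul η F =ᵐ[volume] sliceInv H η h) (ξ : V) :
    H (ξ, η) = laplaceFourier F (ξ, η) := by
  have hm : MemLp (expMul η F) 2 := (Lp.memLp (sliceInv H η h)).ae_eq hFH.symm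
  have h1 : hm.toLp _ = sliceInv H η h := Lp.ext (hm.coeFn_toLp.trans hFH)
  have h2 := Lp_fourier_ae_eq (hF η hη).integrable_expMul hm
  rw [h1, sliceInv, fourier_fourierInv_eq] at h2
  have h3 : (fun ξ => H (ξ, η)) =ᵐ[volume] fun ξ => laplaceFourier F (ξ, η) := by
    refine (h.coeFn_toLp.symm.trans h2).trans (ae_of_all _ fun ξ => ?_)
    exact (laplaceFourier_eq_fourier_expMul F ξ η).symm
  exact congrFun (((hH.continuous_slice hη).ae_eq_iff_eq volume
    ((holomorphicOnTube_laplaceFourier hΩ hF).continuous_slice hη)).1 h3) ξ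

end TubeTransform

/-! ### The scalar Paley-Wiener theorem over the negative octant. -/

section Octant

variable {n : ℕ}

theorem isOpen_negOctant : IsOpen (negOctant n) := by
  simp only [negOctant, Set.ofPred_forall]
  exact isOpen_iInter_of_finite fun i => isOpen_lt (by fun_prop) continuous_const

theorem convex_negOctant : Convex ℝ (negOctant n) := by
  intro x hx y hy a b ha hb hab i
  have h1 := hx i
  have h2 := hy i
  simp only [PiLp.add_apply, PiLp.smul_apply, smul_eq_mul]
  rcases ha.eq_or_lt with rfl | ha
  · have : b = 1 := by linarith
    subst this
    linarith
  · nlinarith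

/-- The diagonal vector `(-t, …, -t)`. -/
def negDiag (n : ℕ) (t : ℝ) : Rn n := WithLp.toLp 2 fun _ => -t

theorem negDiag_mem {t : ℝ} (ht : 0 < t) : negDiag n t ∈ negOctant n := fun i => by
  simpa [negDiag] using ht

theorem inner_negDiag (x : Rn n) (t : ℝ) : ⟪x, negDiag n t⟫ = -t * ∑ i, x i := by
  simp [negDiag, PiLp.inner_apply, Finset.mul_sum, mul_comm]

theorem exists_inner_le_neg_mul_norm {η : Rn n} (hη : η ∈ negOctant n) :
    ∃ δ > 0, ∀ x ∈ posOctant n, ⟪x, η⟫ ≤ -(δ * ‖x‖) := by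
  obtain ⟨δ, hδ, h⟩ : ∃ δ > 0, ∀ i, η i ≤ -δ := by
    -- For `n = 0` there is no coordinate to maximize and any positive `δ` works; otherwise `δ` is
    -- the smallest `|η i|`.
    rcases isEmpty_or_nonempty (Fin n) with hn | hn
    · exact ⟨1, one_pos, fun i => hn.elim i⟩
    · obtain ⟨j, hj⟩ := Finite.exists_max fun i => η i
      exact ⟨-η j, neg_pos.2 (hη j), fun i => by simpa using hj i⟩
  refine ⟨δ, hδ, fun x hx => ?_⟩
  have h1 : ‖x‖ ≤ ∑ i, x i := by
    have : ‖x‖ ≤ ∑ i, ‖x i‖ := by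
      rw [EuclideanSpace.norm_eq]
      refine Real.sqrt_le_iff.2 ⟨Finset.sum_nonneg fun _ _ => norm_nonneg _, ?_⟩
      exact Finset.sum_sq_le_sq_sum_of_nonneg fun _ _ => norm_nonneg _
    refine this.trans (le_of_eq (Finset.sum_congr rfl fun i _ => ?_))
    exact Real.norm_of_nonneg (hx i).le
  have h2 : ⟪x, η⟫ ≤ ∑ i, x i * -δ := by
    rw [PiLp.inner_apply]
    refine Finset.sum_le_sum fun i _ => ?_
    have := mul_le_mul_of_nonneg_left (h i) (hx i).le
    simpa [mul_comm] using this
  rw [← Finset.sum_mul] at h2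
  nlinarith

theorem memLp_exp_neg_norm {V : Type*} [NormedAddCommGroup V] [InnerProductSpace ℝ V]
    [FiniteDimensional ℝ V] [MeasurableSpace V] [BorelSpace V] {c : ℝ} (hc : 0 < c) :
    MemLp (fun x : V => Real.exp (-(c * ‖x‖))) 2 := by
  have hcont : Continuous fun x : V => Real.exp (-(c * ‖x‖)) := by fun_prop
  rw [memLp_two_iff_integrable_sq hcont.aestronglyMeasurable]
  let N : ℕ := Module.finrank ℝ V + 1
  have hr : (Module.finrank ℝ V : ℝ) < N := by simp [N]
  obtain ⟨C, hC⟩ : ∃ C, ∀ t : ℝ, 0 ≤ t → Real.exp (-(c * t)) ^ 2 ≤ C * (1 + t) ^ (-(N : ℝ)) := by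
    -- The constant comes from keeping only the `N`-th term of the exponential series at `2c(1 +
    -- t)`.
    refine ⟨N.factorial / (2 * c) ^ N * Real.exp (2 * c), fun t ht => ?_⟩
    have h1 := Real.pow_div_factorial_le_exp (x := 2 * c * (1 + t)) (by positivity) N
    rw [Real.rpow_neg (by positivity), Real.rpow_natCast, ← Real.exp_nat_mul,
      ← div_eq_mul_inv, le_div_iff₀ (by positivity)]
    have h2 : Real.exp (2 * c * (1 + t)) = Real.exp (2 * c) * Real.exp (2 * c * t) := by
      rw [← Real.exp_add]; ring_nf
    have h3 : Real.exp ((2 : ℕ) * -(c * t)) * Real.exp (2 * c * t) = 1 := by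
      rw [← Real.exp_add]
      simp
      ring
    rw [h2, mul_pow] at h1
    calc _ = Real.exp ((2 : ℕ) * -(c * t)) * (N.factorial / (2 * c) ^ N) *
          ((2 * c) ^ N * (1 + t) ^ N / N.factorial) := by field_simp
      _ ≤ Real.exp ((2 : ℕ) * -(c * t)) * (N.factorial / (2 * c) ^ N) *
          (Real.exp (2 * c) * Real.exp (2 * c * t)) := by gcongr
      _ = (Real.exp ((2 : ℕ) * -(c * t)) * Real.exp (2 * c * t)) *
          (N.factorial / (2 * c) ^ N * Real.exp (2 * c)) := by ring
      _ = _ := by rw [h3, one_mul]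
  refine ((integrable_one_add_norm (μ := volume) hr).const_mul C).mono'
    (by fun_prop) (ae_of_all _ fun x => ?_)
  rw [Real.norm_of_nonneg (by positivity)]
  exact hC ‖x‖ (norm_nonneg x)

theorem expIntegrable_of_memLp {F : Rn n → ℂ} (hF : MemLp F 2)
    (h0 : ∀ᵐ x, x ∉ posOctant n → F x = 0) {η : Rn n} (hη : η ∈ negOctant n) :
    ExpIntegrable F η := by
  obtain ⟨δ, hδ, h⟩ := exists_inner_le_neg_mul_norm hη
  have hpi := Real.pi_pos
  -- The weight decays like `e^{-2πδ‖x‖}`: half of the rate is given to the margin, and the other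
  -- half is an `L²` factor for Cauchy-Schwarz against `F`.
  refine ⟨Real.pi * δ, by positivity, ?_⟩
  have h1 : Integrable fun x : Rn n => Real.exp (-(Real.pi * δ * ‖x‖)) * ‖F x‖ :=
    MemLp.integrable_mul (p := 2) (q := 2) (memLp_exp_neg_norm (by positivity)) hF.norm
  have hc : Continuous fun x : Rn n =>
      (Real.exp (2 * Real.pi * ⟪x, η⟫ + Real.pi * δ * ‖x‖) : ℂ) := by fun_prop
  refine h1.mono' (hc.aestronglyMeasurable.mul hF.1) ?_
  filter_upwards [h0] with x hx
  by_cases hxo : x ∈ posOctant n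
  · rw [norm_mul, Complex.norm_real, Real.norm_of_nonneg (Real.exp_pos _).le]
    gcongr
    nlinarith [h x hxo]
  · simp [hx hxo]

theorem measure_coord_eq_zero (i : Fin n) : (volume : Measure (Rn n)) {x | x i = 0} = 0 := by
  let L : Rn n →ₗ[ℝ] ℝ := (EuclideanSpace.proj i : Rn n →L[ℝ] ℝ).toLinearMap
  have : {x : Rn n | x i = 0} = (LinearMap.ker L : Set (Rn n)) := by
    ext x
    simp [L]
  rw [this]
  refine Measure.addHaar_submodule _ _ fun h => ?_
  have h1 : EuclideanSpace.single i (1 : ℝ) ∈ LinearMap.ker L := h ▸ Submodule.mem_top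
  simp [L] at h1

theorem enorm_expMul {V : Type*} [NormedAddCommGroup V] [InnerProductSpace ℝ V]
    (η : V) (F : V → ℂ) (x : V) :
    ‖expMul η F x‖ₑ = ENNReal.ofReal (Real.exp (2 * Real.pi * ⟪x, η⟫)) * ‖F x‖ₑ := by
  rw [expMul, enorm_mul, ← ofReal_norm, Complex.norm_real,
    Real.norm_of_nonneg (Real.exp_pos _).le]

theorem eLpNorm_two_sq {α E : Type*} [MeasurableSpace α] [NormedAddCommGroup E] (μ : Measure α)
    (f : α → E) : eLpNorm f 2 μ ^ 2 = ∫⁻ x, ‖f x‖ₑ ^ 2 ∂μ := by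
  rw [eLpNorm_eq_lintegral_rpow_enorm_toReal (by norm_num) (by norm_num)]
  rw [← ENNReal.rpow_natCast, ← ENNReal.rpow_mul]
  simp

/-- Where `x i < 0` the weight blows up as `η` runs to infinity along the negative `i`-th axis. By
Fatou the limit inferior is finite almost everywhere, so `F` must vanish there; the hyperplanes `x i
= 0` are null. -/
theorem ae_eq_zero_of_lintegral_expMul_le {F : Rn n → ℂ} (hF : AEStronglyMeasurable F volume)
    {C : ℝ≥0} (hC : ∀ η ∈ negOctant n, ∫⁻ x, ‖expMul η F x‖ₑ ^ 2 ≤ C) :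
    ∀ᵐ x, x ∉ posOctant n → F x = 0 := by
  have key : ∀ i : Fin n, ∀ᵐ x : Rn n, x i < 0 → F x = 0 := by
    intro i
    let η : ℕ → Rn n := fun N => negDiag n 1 - (N : ℝ) • EuclideanSpace.single i (1 : ℝ)
    have hη : ∀ N, η N ∈ negOctant n := fun N j => by
      have : (0 : ℝ) ≤ (N : ℝ) * (if j = i then 1 else 0) := by positivity
      simp only [η, negDiag, PiLp.sub_apply, PiLp.smul_apply, PiLp.single_apply,
        smul_eq_mul]
      linarith
    have hin : ∀ N x, ⟪x, η N⟫ = ⟪x, negDiag n 1⟫ - N * x i := fun N x => by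
      simp [η, inner_sub_right, inner_smul_right, EuclideanSpace.inner_single_right]
    have hm : ∀ N, AEMeasurable (fun x => ‖expMul (η N) F x‖ₑ ^ 2) volume := fun N =>
      (aestronglyMeasurable_expMul hF _).enorm.pow_const 2
    have h1 : ∫⁻ x, Filter.liminf (fun N => ‖expMul (η N) F x‖ₑ ^ 2) Filter.atTop ≤ C := by
      refine (lintegral_liminf_le' hm).trans ?_
      exact (Filter.liminf_le_liminf (Filter.Eventually.of_forall fun N => hC _ (hη N))).trans
        (by simp)
    have hml : AEMeasurable (fun x => Filter.liminf (fun N => ‖expMul (η N) F x‖ₑ ^ 2)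
        Filter.atTop) volume := by
      simp only [Filter.liminf_eq_iSup_iInf_of_nat]
      exact .iSup fun N => .biInf _ (Set.to_countable _) fun k _ => hm k
    have h2 := ae_lt_top' hml (h1.trans_lt ENNReal.coe_lt_top).ne
    filter_upwards [h2] with x hx hxi
    by_contra hFx
    refine hx.ne (Filter.Tendsto.liminf_eq ?_)
    have h3 : Filter.Tendsto (fun N : ℕ => Real.exp (2 * Real.pi * ⟪x, η N⟫)) Filter.atTop
        Filter.atTop := by
      refine Real.tendsto_exp_atTop.comp (Filter.Tendsto.const_mul_atTop (by positivity) ?_)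
      simp only [hin, sub_eq_add_neg]
      refine Filter.tendsto_atTop_add_const_left _ _ ?_
      simp only [← mul_neg]
      exact tendsto_natCast_atTop_atTop.atTop_mul_const (neg_pos.2 hxi)
    have h4 : Filter.Tendsto (fun N : ℕ => ‖expMul (η N) F x‖ₑ) Filter.atTop (𝓝 ⊤) := by
      simp only [enorm_expMul]
      have := ENNReal.Tendsto.mul_const (b := ‖F x‖ₑ) (ENNReal.tendsto_ofReal_atTop.comp h3)
        (Or.inl ENNReal.top_ne_zero)
      rwa [ENNReal.top_mul (by simpa using hFx)] at this
    simpa [Function.comp_def] using ((ENNReal.continuous_pow 2).tendsto _).comp h4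
  have h0 : ∀ᵐ x : Rn n, ∀ i, x i ≠ 0 := ae_all_iff.2 fun i => by
    simpa [ae_iff] using measure_coord_eq_zero i
  filter_upwards [ae_all_iff.2 key, h0] with x hx hx0 hxo
  simp only [posOctant, Set.mem_ofPred_eq, not_forall, not_lt] at hxo
  obtain ⟨i, hi⟩ := hxo
  exact hx i (lt_of_le_of_ne hi (hx0 i))

theorem tendsto_expMul_negDiag {F : Rn n → ℂ} (x : Rn n) :
    Filter.Tendsto (fun N : ℕ => ‖expMul (negDiag n (1 / ((N : ℝ) + 1))) F x‖ₑ ^ 2) Filter.atTop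
      (𝓝 (‖F x‖ₑ ^ 2)) := by
  have h1 : Filter.Tendsto (fun N : ℕ => expMul (negDiag n (1 / ((N : ℝ) + 1))) F x) Filter.atTop
      (𝓝 (F x)) := by
    have h2 : Filter.Tendsto (fun N : ℕ => 2 * Real.pi * ⟪x, negDiag n (1 / ((N : ℝ) + 1))⟫)
        Filter.atTop (𝓝 0) := by
      simp only [inner_negDiag]
      simpa using ((tendsto_one_div_add_atTop_nhds_zero_nat (𝕜 := ℝ)).neg.mul_const
        (∑ i, x i)).const_mul (2 * Real.pi)
    have h3 := (Complex.continuous_ofReal.tendsto _).comp ((Real.continuous_exp.tendsto 0).comp h2)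
    simpa [expMul, Function.comp_def] using h3.mul_const (F x)
  exact ((ENNReal.continuous_pow 2).tendsto _).comp h1.enorm

/-- Fatou along the diagonal `η → 0`, where the weight tends to `1`. -/
theorem lintegral_le_of_lintegral_expMul_le {μ : Measure (Rn n)} {F : Rn n → ℂ}
    (hF : AEStronglyMeasurable F μ)
    {C : ℝ≥0∞} (hC : ∀ η ∈ negOctant n, ∫⁻ x, ‖expMul η F x‖ₑ ^ 2 ∂μ ≤ C) :
    ∫⁻ x, ‖F x‖ₑ ^ 2 ∂μ ≤ C := by
  calc ∫⁻ x, ‖F x‖ₑ ^ 2 ∂μ = ∫⁻ x, Filter.liminf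
        (fun N : ℕ => ‖expMul (negDiag n (1 / ((N : ℝ) + 1))) F x‖ₑ ^ 2) Filter.atTop ∂μ := by
        simp only [(tendsto_expMul_negDiag _).liminf_eq]
    _ ≤ _ := lintegral_liminf_le' fun N => (aestronglyMeasurable_expMul hF _).enorm.pow_const 2
    _ ≤ Filter.liminf (fun _ : ℕ => C) Filter.atTop :=
        Filter.liminf_le_liminf (Filter.Eventually.of_forall fun N =>
          hC _ (negDiag_mem (by positivity)))
    _ = C := by simp

theorem exists_eq_laplaceFourier {H : Rn n × Rn n → ℂ} (hH : HolomorphicOnTube H (negOctant n))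
    {C : ℝ≥0} (hC : ∀ η ∈ negOctant n, ∫⁻ ξ, ‖H (ξ, η)‖ₑ ^ 2 ≤ C) :
    ∃ F : Rn n → ℂ, MemLp F 2 ∧ (∀ x, x ∉ posOctant n → F x = 0) ∧
      ∀ η ∈ negOctant n, ∀ ξ, H (ξ, η) = laplaceFourier F (ξ, η) := by
  have hle : ∀ η ∈ negOctant n, eLpNorm (fun ξ => H (ξ, η)) 2 volume ≤ NNReal.sqrt C := by
    intro η hη
    rw [← ENNReal.pow_le_pow_left_iff two_ne_zero, eLpNorm_two_sq, ← ENNReal.coe_pow,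
      NNReal.sq_sqrt]
    exact hC η hη
  have hL : ∀ η ∈ negOctant n, MemLp (fun ξ => H (ξ, η)) 2 := fun η hη =>
    ⟨(hH.continuous_slice hη).aestronglyMeasurable, (hle η hη).trans_lt ENNReal.coe_lt_top⟩
  obtain ⟨F, hFm, hF⟩ := exists_expMul_eq_sliceInv isOpen_negOctant convex_negOctant
    ⟨_, negDiag_mem one_pos⟩ hH hL hle
  have hB : ∀ η ∈ negOctant n, ∫⁻ x, ‖expMul η F x‖ₑ ^ 2 ≤ C := by
    intro η hη
    rw [← eLpNorm_two_sq, eLpNorm_congr_ae (hF η hη), eLpNorm_sliceInv, eLpNorm_two_sq]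
    exact hC η hη
  have h0 := ae_eq_zero_of_lintegral_expMul_le hFm hB
  have h2 := lintegral_le_of_lintegral_expMul_le hFm hB
  have hF2 : MemLp F 2 := by
    refine ⟨hFm, ?_⟩
    rw [← eLpNorm_two_sq] at h2
    by_contra h
    rw [not_lt, top_le_iff] at h
    simp [h] at h2
  -- Passing to the indicator makes the vanishing hold at every point outside the octant, not only
  -- almost everywhere.
  have hind : (posOctant n).indicator F =ᵐ[volume] F := by
    filter_upwards [h0] with x hx
    by_cases hxo : x ∈ posOctant n
    · simp [hxo]
    · simp [hxo, hx hxo]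
  have hI0 : ∀ x, x ∉ posOctant n → (posOctant n).indicator F x = 0 := fun x hx =>
    Set.indicator_of_notMem hx F
  have hI2 : MemLp ((posOctant n).indicator F) 2 := hF2.ae_eq hind.symm
  refine ⟨_, hI2, hI0, fun η hη ξ => ?_⟩
  refine eq_laplaceFourier_of_expMul_eq_sliceInv isOpen_negOctant hH
    (fun η hη => expIntegrable_of_memLp hI2 (ae_of_all _ hI0) hη) hη (hL η hη) ?_ ξ
  refine Filter.EventuallyEq.trans ?_ (hF η hη)
  filter_upwards [hind] with x hx
  simp only [expMul, hx]

end Octant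

/-! ### Simultaneous diagonalization of commuting isometric complex structures. -/

section SpectralFrame

/-- A Parseval frame of real-linear functionals `coord k : E → ℂ` which turns each operator `T i`,
`i ∈ S`, into multiplication by `± i`, with reconstruction maps `recon k : ℂ → E`. -/
structure SpectralFrame {E ι : Type*} [NormedAddCommGroup E] [InnerProductSpace ℝ E]
    (T : ι → E →ₗ[ℝ] E) (S : Finset ι) where
  /-- The index type. -/
  K : Type
  /-- The index type is finite. -/
  fintypeK : Fintype K
  /-- The sign of the eigenvalue of `T i`. -/
  sign : K → ι → ℝ
  /-- The coordinate functionals. -/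
  coord : K → E →ₗ[ℝ] ℂ
  /-- The reconstruction maps. -/
  recon : K → ℂ →ₗ[ℝ] E
  sign_mul_self : ∀ k i, sign k i * sign k i = 1
  coord_apply : ∀ k, ∀ i ∈ S, ∀ a, coord k (T i a) = I * sign k i * coord k a
  recon_mul : ∀ k, ∀ i ∈ S, ∀ z, recon k (I * sign k i * z) = T i (recon k z)
  sum_norm_sq : ∀ a, ∑ k, ‖coord k a‖ ^ 2 = ‖a‖ ^ 2
  sum_recon : ∀ a, ∑ k, recon k (coord k a) = a

variable {E ι : Type*} [NormedAddCommGroup E] [InnerProductSpace ℝ E]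

theorem nonempty_spectralFrame_empty [FiniteDimensional ℝ E] (T : ι → E →ₗ[ℝ] E) :
    Nonempty (SpectralFrame T ∅) := by
  let b := stdOrthonormalBasis ℝ E
  exact ⟨{
    K := Fin (Module.finrank ℝ E)
    fintypeK := inferInstance
    sign := fun _ _ => 1
    coord := fun k => Complex.ofRealCLM.toLinearMap ∘ₗ (innerₗ E (b k))
    recon := fun k => (LinearMap.toSpanSingleton ℝ E (b k)) ∘ₗ Complex.reLm
    sign_mul_self := fun _ _ => one_mul 1
    coord_apply := by simp
    recon_mul := by simp
    sum_norm_sq := fun a => by simpa using b.sum_sq_norm_inner_right a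
    sum_recon := fun a => by simpa using b.sum_repr' a }⟩

/-- The sign attached to a Boolean. -/
def boolSign (ε : Bool) : ℝ := cond ε 1 (-1)

theorem boolSign_mul_self (ε : Bool) : boolSign ε * boolSign ε = 1 := by
  cases ε <;> simp [boolSign]

theorem normSq_add_normSq_half (u w : ℂ) :
    ‖(1 / 2 : ℂ) * (u - I * w)‖ ^ 2 + ‖(1 / 2 : ℂ) * (u + I * w)‖ ^ 2 =
      (‖u‖ ^ 2 + ‖w‖ ^ 2) / 2 := by
  simp only [← Complex.normSq_eq_norm_sq, Complex.normSq_apply]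
  simp
  ring

/-- Each functional is split into its two parts on which `T j` acts as `± i`, namely `(coord ∓ i ·
coord ∘ T j) / 2`. The parallelogram law with `T j` isometric keeps the Parseval identity, and `T j
∘ T j = -1` keeps the reconstruction. Asking for a frame rather than a basis allows the index set to
double at each step. -/
theorem nonempty_spectralFrame_insert [DecidableEq ι] {T : ι → E →ₗ[ℝ] E} {S : Finset ι}
    (hcomm : ∀ i j a, T i (T j a) = T j (T i a)) (hsq : ∀ i a, T i (T i a) = -a)
    (hiso : ∀ i a, ‖T i a‖ = ‖a‖) {j : ι} (hj : j ∉ S) (Φ : SpectralFrame T S) :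
    Nonempty (SpectralFrame T (insert j S)) := by
  let _ := Φ.fintypeK
  have hupd : ∀ k (ε : Bool), ∀ i ∈ S,
      Function.update (Φ.sign k) j (boolSign ε) i = Φ.sign k i := fun k ε i hi =>
    Function.update_of_ne (ne_of_mem_of_not_mem hi hj) _ _
  let mulI : ℂ →ₗ[ℝ] ℂ := LinearMap.mulLeft ℝ I
  let co : Φ.K × Bool → E →ₗ[ℝ] ℂ := fun q =>
    (1 / 2 : ℝ) • (Φ.coord q.1 - boolSign q.2 • (mulI ∘ₗ Φ.coord q.1 ∘ₗ T j))
  let re : Φ.K × Bool → ℂ →ₗ[ℝ] E := fun q =>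
    (1 / 2 : ℝ) • (Φ.recon q.1 - boolSign q.2 • (T j ∘ₗ Φ.recon q.1 ∘ₗ mulI))
  have hco : ∀ k ε a, co (k, ε) a =
      (1 / 2 : ℂ) * (Φ.coord k a - boolSign ε * (I * Φ.coord k (T j a))) := fun k ε a => by
    simp [co, mulI]
  have hre : ∀ k ε z, re (k, ε) z =
      (1 / 2 : ℝ) • (Φ.recon k z - boolSign ε • T j (Φ.recon k (I * z))) := fun k ε z => by
    simp [re, mulI]
  exact ⟨{
    K := Φ.K × Bool
    fintypeK := inferInstance
    sign := fun q => Function.update (Φ.sign q.1) j (boolSign q.2)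
    coord := co
    recon := re
    sign_mul_self := by
      rintro ⟨k, ε⟩ i
      by_cases hi : i = j
      · subst hi
        simpa using boolSign_mul_self ε
      · simpa [hi] using Φ.sign_mul_self k i
    coord_apply := by
      rintro ⟨k, ε⟩ i hi a
      rw [hco, hco]
      rcases Finset.mem_insert.1 hi with rfl | hi
      · simp only [Function.update_self, hsq, map_neg]
        have hb : (boolSign ε : ℂ) * boolSign ε = 1 := by exact_mod_cast boolSign_mul_self ε
        linear_combination (1 / 2 : ℂ) * Φ.coord k (T i a) * (I * I * hb + I_mul_I)
      · rw [hupd k ε i hi, ← hcomm i j, Φ.coord_apply k i hi, Φ.coord_apply k i hi]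
        ring
    recon_mul := by
      rintro ⟨k, ε⟩ i hi z
      rw [hre, hre]
      rcases Finset.mem_insert.1 hi with rfl | hi
      · simp only [Function.update_self, map_smul, map_sub, hsq]
        have h1 : I * boolSign ε * z = boolSign ε • (I * z) := by
          rw [Complex.real_smul]; ring
        have h2 : I * (boolSign ε • (I * z)) = -(boolSign ε • z) := by
          rw [Complex.real_smul, Complex.real_smul]
          linear_combination (boolSign ε * z : ℂ) * I_mul_I
        rw [h1, h2, map_neg, map_smul, map_smul, map_neg, map_smul, smul_neg, smul_smul,
          boolSign_mul_self, one_smul, smul_neg]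
        abel_nf
      · rw [hupd k ε i hi, Φ.recon_mul k i hi]
        have h1 : I * (I * Φ.sign k i * z) = I * Φ.sign k i * (I * z) := by ring
        rw [h1, Φ.recon_mul k i hi, hcomm j i]
        simp only [map_smul, map_sub]
    sum_norm_sq := fun a => by
      rw [Fintype.sum_prod_type]
      have : ∀ k, ∑ ε, ‖co (k, ε) a‖ ^ 2 =
          (‖Φ.coord k a‖ ^ 2 + ‖Φ.coord k (T j a)‖ ^ 2) / 2 := fun k => by
        rw [Fintype.sum_bool, hco, hco, ← normSq_add_normSq_half]
        simp [boolSign]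
      simp only [this]
      rw [← Finset.sum_div, Finset.sum_add_distrib, Φ.sum_norm_sq, Φ.sum_norm_sq, hiso]
      ring
    sum_recon := fun a => by
      rw [Fintype.sum_prod_type]
      have : ∀ k, ∑ ε, re (k, ε) (co (k, ε) a) =
          (1 / 2 : ℝ) • (Φ.recon k (Φ.coord k a) - T j (Φ.recon k (Φ.coord k (T j a)))) :=
        fun k => by
          rw [Fintype.sum_bool, hre, hre]
          have h1 : co (k, true) a + co (k, false) a = Φ.coord k a := by
            rw [hco, hco]; simp [boolSign]; ring
          have h2 : I * co (k, true) a - I * co (k, false) a = Φ.coord k (T j a) := by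
            rw [hco, hco]
            simp [boolSign]
            linear_combination (-Φ.coord k (T j a)) * I_mul_I
          conv_rhs => rw [← h2, ← h1]
          simp only [boolSign, cond_true, cond_false, map_sub, map_add, one_smul, neg_smul]
          rw [← smul_add]
          congr 1
          abel
      simp only [this]
      rw [← Finset.smul_sum, Finset.sum_sub_distrib, ← map_sum, Φ.sum_recon, Φ.sum_recon, hsq,
        sub_neg_eq_add, ← two_smul ℝ a, smul_smul]
      norm_num }⟩

theorem nonempty_spectralFrame [FiniteDimensional ℝ E] {T : ι → E →ₗ[ℝ] E}
    (hcomm : ∀ i j a, T i (T j a) = T j (T i a)) (hsq : ∀ i a, T i (T i a) = -a)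
    (hiso : ∀ i a, ‖T i a‖ = ‖a‖) (S : Finset ι) : Nonempty (SpectralFrame T S) := by
  classical
  induction S using Finset.induction_on with
  | empty => exact nonempty_spectralFrame_empty T
  | insert j S hj ih => exact ih.elim fun Φ => nonempty_spectralFrame_insert hcomm hsq hiso hj Φ

end SpectralFrame

/-! ### The bivectors `B i` and the kernel inside the Clifford algebra. -/

section Algebra

variable {n : ℕ}

theorem vec_e (i : Fin n) : vec (e i) = gen (Sum.inl i) := rfl

theorem vec_e' (i : Fin n) : vec (e' i) = gen (Sum.inr i) := rfl

theorem B_eq (i : Fin n) : (B i : G n) = gen (Sum.inl i) * gen (Sum.inr i) := rfl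

theorem gen_e'_mul_gen_e (i : Fin n) :
    (gen (Sum.inr i) * gen (Sum.inl i) : G n) = -B i := by
  rw [gen_anticomm (by simp), B_eq]

theorem B_mul_self (i : Fin n) : (B i * B i : G n) = -1 := by
  calc (B i * B i : G n)
      = gen (Sum.inl i) * (gen (Sum.inr i) * gen (Sum.inl i)) * gen (Sum.inr i) := by
        simp only [B_eq, mul_assoc]
    _ = -((gen (Sum.inl i) * gen (Sum.inl i)) * (gen (Sum.inr i) * gen (Sum.inr i))) := by
        rw [gen_anticomm (by simp : (Sum.inr i : Fin n ⊕ Fin n) ≠ Sum.inl i)]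
        simp only [mul_neg, neg_mul, mul_assoc]
    _ = -1 := by rw [gen_sq, gen_sq, one_mul]

theorem B_mul_gen_comm {i : Fin n} {k : Fin n ⊕ Fin n} (h1 : k ≠ Sum.inl i)
    (h2 : k ≠ Sum.inr i) : (B i * gen k : G n) = gen k * B i := by
  rw [B_eq, mul_assoc, gen_anticomm h2.symm, mul_neg, ← mul_assoc, gen_anticomm h1.symm, neg_mul,
    neg_neg, mul_assoc]

theorem B_comm (i j : Fin n) : (B i * B j : G n) = B j * B i := by
  by_cases h : i = j
  · rw [h]
  · rw [B_eq j, ← mul_assoc, B_mul_gen_comm (by simpa using Ne.symm h) (by simp), mul_assoc,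
      B_mul_gen_comm (by simp) (by simpa using Ne.symm h), mul_assoc]

theorem norm_sq_coord (a : Finset (Fin n ⊕ Fin n) → ℝ) :
    ‖∑ I, a I • (blade I : G n)‖ ^ 2 = ∑ I, a I * a I := by
  rw [norm_sq_eq]
  exact scalarProd_coord a a

theorem norm_reverse (A : G n) : ‖CliffordAlgebra.reverse A‖ = ‖A‖ := by
  obtain ⟨a, rfl⟩ := exists_coord A
  have hs : ∀ I : Finset (Fin n ⊕ Fin n), ∃ s : ℝ, s * s = 1 ∧
      CliffordAlgebra.reverse (blade I : G n) = s • blade I := fun I => by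
    rcases reverse_blade (n := n) I with h | h
    · exact ⟨1, by simp, by simp [h]⟩
    · exact ⟨-1, by simp, by simp [h]⟩
  choose s hs1 hs2 using hs
  rw [← sq_eq_sq₀ (norm_nonneg _) (norm_nonneg _), norm_sq_coord, map_sum]
  simp only [map_smul, hs2, smul_smul]
  rw [norm_sq_coord]
  refine Finset.sum_congr rfl fun I _ => ?_
  linear_combination a I * a I * hs1 I

theorem norm_gen_mul (j : Fin n ⊕ Fin n) (A : G n) : ‖gen j * A‖ = ‖A‖ := by
  have hj : CliffordAlgebra.reverse (gen j : G n) = gen j := by simp [gen, vec]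
  -- After reversal the squared norm is `⟨A†A⟩₀`, which brings the two copies of the generator
  -- together so that they cancel.
  rw [← norm_reverse, ← norm_reverse A, ← sq_eq_sq₀ (norm_nonneg _) (norm_nonneg _), norm_sq_eq,
    norm_sq_eq]
  simp only [CliffordAlgebra.reverse.map_mul, hj, CliffordAlgebra.reverse_reverse]
  rw [mul_assoc, ← mul_assoc (gen j), gen_sq, one_mul]

theorem norm_B_mul (i : Fin n) (A : G n) : ‖B i * A‖ = ‖A‖ := by
  rw [B_eq, mul_assoc, norm_gen_mul, norm_gen_mul]

/-- Left multiplication by the bivectors `Bᵢ`. -/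
def Bmul (i : Fin n) : G n →ₗ[ℝ] G n := LinearMap.mulLeft ℝ (B i)

theorem Bmul_apply (i : Fin n) (A : G n) : Bmul i A = B i * A := rfl

theorem nonempty_cliffordFrame (n : ℕ) :
    Nonempty (SpectralFrame (Bmul (n := n)) Finset.univ) :=
  nonempty_spectralFrame
    (fun i j a => by rw [Bmul_apply, Bmul_apply, Bmul_apply, Bmul_apply, ← mul_assoc, B_comm i j,
      mul_assoc])
    (fun i a => by rw [Bmul_apply, Bmul_apply, ← mul_assoc, B_mul_self, neg_one_mul])
    (fun i a => by rw [Bmul_apply, norm_B_mul]) _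

theorem incl_inl (x : Rn n) (i : Fin n) : incl x (Sum.inl i) = x i := by
  simp [incl, e, Pi.single_apply]

theorem incl_inr (x : Rn n) (i : Fin n) : incl x (Sum.inr i) = 0 := by
  simp [incl, e]

theorem incl'_inl (x : Rn n) (i : Fin n) : incl' x (Sum.inl i) = 0 := by
  simp [incl', e']

theorem incl'_inr (x : Rn n) (i : Fin n) : incl' x (Sum.inr i) = x i := by
  simp [incl', e', Pi.single_apply]

theorem mem_tube_iff {v : R2n n} : v ∈ tube n ↔ ∀ i, v (Sum.inr i) < 0 := by
  constructor
  · rintro ⟨y, y', hy', rfl⟩ i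
    simpa [incl_inr, incl'_inr] using hy' i
  · intro h
    refine ⟨WithLp.toLp 2 fun i => v (Sum.inl i), WithLp.toLp 2 fun i => v (Sum.inr i), h, ?_⟩
    ext (i | i) <;> simp [incl_inl, incl_inr, incl'_inl, incl'_inr]

theorem isOpen_cliffordTube : IsOpen (tube n) := by
  have : tube n = ⋂ i, {v : R2n n | v (Sum.inr i) < 0} := by
    ext v
    simp [mem_tube_iff]
  rw [this]
  exact isOpen_iInter_of_finite fun i => isOpen_lt (by fun_prop) continuous_const

/-- `B i * e i * e i = B i` and `B i * e i * e' i = B i * B i = -1`: the kernel involves only the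
commuting `B i` and scalars. -/
theorem Iform_incl (x : Rn n) (v : R2n n) :
    Iform (incl x) v = ∑ i, ((x i * v (Sum.inl i)) • (B i : G n) - (x i * v (Sum.inr i)) • 1) := by
  refine Finset.sum_congr rfl fun i _ => ?_
  have h1 : vec (P i (incl x)) = x i • (gen (Sum.inl i) : G n) := by
    simp [P, incl_inl, incl_inr, ← vec_e, vec]
  have h2 : vec (P i v) = v (Sum.inl i) • (gen (Sum.inl i) : G n) +
      v (Sum.inr i) • gen (Sum.inr i) := by
    simp [P, ← vec_e, ← vec_e', vec]
  rw [h1, h2, mul_add]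
  simp only [smul_mul_assoc, mul_smul_comm, smul_smul]
  rw [mul_assoc, gen_sq, mul_one, mul_assoc, ← B_eq, B_mul_self, smul_neg, sub_eq_add_neg,
    mul_comm (v (Sum.inl i)), mul_comm (v (Sum.inr i))]

/-- Multiplying by `e' i` turns the monogenic equation into a Cauchy-Riemann equation with `B i` as
imaginary unit. -/
theorem monogenic_iff (i : Fin n) (a b : G n) :
    vec (e i) * a + vec (e' i) * b = 0 ↔ b = B i * a := by
  rw [vec_e, vec_e']
  constructor
  · intro h
    have h1 := congrArg (fun c => gen (Sum.inr i) * c) h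
    simp only [mul_add, ← mul_assoc, gen_sq, gen_e'_mul_gen_e, mul_zero, neg_mul, one_mul] at h1
    exact (neg_add_eq_zero.1 h1).symm
  · rintro rfl
    rw [← mul_assoc, B_eq, ← mul_assoc, gen_anticomm (by simp : (Sum.inr i : Fin n ⊕ Fin n) ≠ _),
      neg_mul, mul_assoc (gen (Sum.inl i)), gen_sq, mul_one, neg_mul, add_neg_cancel]

end Algebra

/-- A frame diagonalizing the left multiplications by all the `Bᵢ`. -/
abbrev CliffordFrame (n : ℕ) : Type _ := SpectralFrame (Bmul (n := n)) Finset.univ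

instance {n : ℕ} (Φ : CliffordFrame n) : Fintype Φ.K := Φ.fintypeK

/-! ### The kernel and the variables in frame coordinates. -/

namespace CliffordFrame

variable {n : ℕ} (Φ : CliffordFrame n)

theorem coord_B_mul (k : Φ.K) (i : Fin n) (A : G n) :
    Φ.coord k (B i * A) = I * Φ.sign k i * Φ.coord k A :=
  Φ.coord_apply k i (Finset.mem_univ i) A

theorem recon_sign_mul (k : Φ.K) (i : Fin n) (z : ℂ) :
    Φ.recon k (I * Φ.sign k i * z) = B i * Φ.recon k z :=
  Φ.recon_mul k i (Finset.mem_univ i) z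

/-- The coordinate functionals as continuous linear maps. -/
def coordL (k : Φ.K) : G n →L[ℝ] ℂ := LinearMap.toContinuousLinearMap (Φ.coord k)

/-- The reconstruction maps as continuous linear maps. -/
def reconL (k : Φ.K) : ℂ →L[ℝ] G n := LinearMap.toContinuousLinearMap (Φ.recon k)

theorem coordL_apply (k : Φ.K) (A : G n) : Φ.coordL k A = Φ.coord k A := rfl

theorem reconL_apply (k : Φ.K) (z : ℂ) : Φ.reconL k z = Φ.recon k z := rfl

section Exp

variable {M : G n} {c : Φ.K → ℂ}

theorem coord_pow_mul (hc : ∀ k A, Φ.coord k (M * A) = c k * Φ.coord k A) (k : Φ.K) (j : ℕ)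
    (A : G n) : Φ.coord k (M ^ j * A) = c k ^ j * Φ.coord k A := by
  induction j with
  | zero => simp
  | succ j ih => rw [pow_succ', pow_succ', mul_assoc, hc, ih, mul_assoc]

theorem recon_pow_mul (hr : ∀ k z, Φ.recon k (c k * z) = M * Φ.recon k z) (k : Φ.K) (j : ℕ)
    (z : ℂ) : Φ.recon k (c k ^ j * z) = M ^ j * Φ.recon k z := by
  induction j with
  | zero => simp
  | succ j ih => rw [pow_succ', pow_succ', mul_assoc, hr, ih, mul_assoc]

theorem hasSum_smul_pow_mul (c z : ℂ) :
    HasSum (fun j : ℕ => ((j.factorial : ℝ)⁻¹) • (c ^ j * z)) (cexp c * z) := by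
  have h := (NormedSpace.exp_series_hasSum_exp' (𝕂 := ℝ) c).mul_right z
  rw [← Complex.exp_eq_exp_ℂ] at h
  simpa only [smul_mul_assoc] using h

/-- The norm of `G n` is not submultiplicative for `n ≥ 1` (`(1 + e)² = 2(1 + e)` for a unit vector
`e`), so convergence is read off in the frame, where `M` acts by scalars. -/
theorem hasSum_exp (hc : ∀ k A, Φ.coord k (M * A) = c k * Φ.coord k A) :
    HasSum (fun j : ℕ => ((j.factorial : ℝ)⁻¹) • M ^ j) (NormedSpace.exp M) := by
  have h : HasSum (fun j : ℕ => ((j.factorial : ℝ)⁻¹) • M ^ j)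
      (∑ k, Φ.reconL k (cexp (c k) * Φ.coord k 1)) := by
    have h1 := hasSum_sum (s := (Finset.univ : Finset Φ.K)) fun k _ =>
      (hasSum_smul_pow_mul (c k) (Φ.coord k 1)).mapL (Φ.reconL k)
    convert! h1 using 1
    ext j
    simp only [map_smul, ← Φ.coord_pow_mul hc, mul_one]
    rw [← Finset.smul_sum]
    simp only [reconL_apply, Φ.sum_recon]
  rw [NormedSpace.exp_eq_tsum ℝ]
  exact h.summable.hasSum

theorem coord_exp_mul (hc : ∀ k A, Φ.coord k (M * A) = c k * Φ.coord k A) (k : Φ.K) (A : G n) :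
    Φ.coord k (NormedSpace.exp M * A) = cexp (c k) * Φ.coord k A := by
  have h1 := ((Φ.hasSum_exp hc).mul_right A).mapL (Φ.coordL k)
  refine h1.unique ?_
  convert! hasSum_smul_pow_mul (c k) (Φ.coord k A) using 2 with j
  rw [smul_mul_assoc, map_smul, coordL_apply, Φ.coord_pow_mul hc]

theorem exp_mul_recon (hc : ∀ k A, Φ.coord k (M * A) = c k * Φ.coord k A)
    (hr : ∀ k z, Φ.recon k (c k * z) = M * Φ.recon k z) (k : Φ.K) (z : ℂ) :
    NormedSpace.exp M * Φ.recon k z = Φ.recon k (cexp (c k) * z) := by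
  have h1 := (Φ.hasSum_exp hc).mul_right (Φ.recon k z)
  refine h1.unique ?_
  convert! (hasSum_smul_pow_mul (c k) z).mapL (Φ.reconL k) using 2 with j
  rw [smul_mul_assoc, map_smul, reconL_apply, Φ.recon_pow_mul hr]

end Exp

/-- The sign change attached to an index of the frame. -/
def flip (k : Φ.K) : Rn n ≃ₗᵢ[ℝ] Rn n where
  toFun x := WithLp.toLp 2 fun i => Φ.sign k i * x i
  invFun x := WithLp.toLp 2 fun i => Φ.sign k i * x i
  map_add' x y := by ext i; simp [mul_add]
  map_smul' r x := by ext i; simp; ring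
  left_inv x := by ext i; simp [← mul_assoc, Φ.sign_mul_self]
  right_inv x := by ext i; simp [← mul_assoc, Φ.sign_mul_self]
  norm_map' x := by
    simp only [LinearEquiv.coe_mk, LinearMap.coe_mk, AddHom.coe_mk, EuclideanSpace.norm_eq]
    congr 1
    refine Finset.sum_congr rfl fun i _ => ?_
    rw [norm_mul, mul_pow, ← sq_abs ‖Φ.sign k i‖, abs_norm, Real.norm_eq_abs, sq_abs, sq,
      Φ.sign_mul_self, one_mul]

theorem flip_apply (k : Φ.K) (x : Rn n) (i : Fin n) : Φ.flip k x i = Φ.sign k i * x i := rfl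

/-- Frequency coordinates on `ℝ²ⁿ`: `y + y' ↦ ((2π)⁻¹ S y, (2π)⁻¹ y')`, with `S = flip k`. -/
def toFreq (k : Φ.K) : R2n n →L[ℝ] Rn n × Rn n := LinearMap.toContinuousLinearMap
  { toFun := fun v => (WithLp.toLp 2 fun i => (2 * Real.pi)⁻¹ * (Φ.sign k i * v (Sum.inl i)),
      WithLp.toLp 2 fun i => (2 * Real.pi)⁻¹ * v (Sum.inr i))
    map_add' := fun v w => by ext i <;> simp <;> ring
    map_smul' := fun r v => by ext i <;> simp <;> ring }

theorem toFreq_fst (k : Φ.K) (v : R2n n) (i : Fin n) :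
    (Φ.toFreq k v).1 i = (2 * Real.pi)⁻¹ * (Φ.sign k i * v (Sum.inl i)) := rfl

theorem toFreq_snd (k : Φ.K) (v : R2n n) (i : Fin n) :
    (Φ.toFreq k v).2 i = (2 * Real.pi)⁻¹ * v (Sum.inr i) := rfl

/-- The inverse of `toFreq`. -/
def ofFreq (k : Φ.K) : Rn n × Rn n →L[ℝ] R2n n := LinearMap.toContinuousLinearMap
  { toFun := fun p => WithLp.toLp 2 (Sum.elim (fun i => 2 * Real.pi * (Φ.sign k i * p.1 i))
      fun i => 2 * Real.pi * p.2 i)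
    map_add' := fun v w => by ext (i | i) <;> simp <;> ring
    map_smul' := fun r v => by ext (i | i) <;> simp <;> ring }

theorem ofFreq_inl (k : Φ.K) (p : Rn n × Rn n) (i : Fin n) :
    Φ.ofFreq k p (Sum.inl i) = 2 * Real.pi * (Φ.sign k i * p.1 i) := rfl

theorem ofFreq_inr (k : Φ.K) (p : Rn n × Rn n) (i : Fin n) :
    Φ.ofFreq k p (Sum.inr i) = 2 * Real.pi * p.2 i := rfl

theorem ofFreq_toFreq (k : Φ.K) (v : R2n n) : Φ.ofFreq k (Φ.toFreq k v) = v := by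
  have hpi := Real.pi_ne_zero
  ext (i | i)
  · rw [ofFreq_inl, toFreq_fst]
    field_simp
    linear_combination v (Sum.inl i) * Φ.sign_mul_self k i
  · rw [ofFreq_inr, toFreq_snd]
    field_simp

theorem toFreq_snd_mem {k : Φ.K} {v : R2n n} :
    (Φ.toFreq k v).2 ∈ negOctant n ↔ v ∈ tube n := by
  rw [mem_tube_iff]
  refine forall_congr' fun i => ?_
  rw [toFreq_snd]
  exact smul_neg_iff_of_pos_left (a := (2 * Real.pi)⁻¹) (by positivity)

theorem ofFreq_mem_tube {k : Φ.K} {p : Rn n × Rn n} (hp : p.2 ∈ negOctant n) :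
    Φ.ofFreq k p ∈ tube n := by
  rw [mem_tube_iff]
  intro i
  rw [ofFreq_inr]
  exact mul_neg_of_pos_of_neg (by positivity) (hp i)

theorem toFreq_incl_add (k : Φ.K) (y y' : Rn n) :
    Φ.toFreq k (incl y + incl' y') = ((2 * Real.pi)⁻¹ • Φ.flip k y, (2 * Real.pi)⁻¹ • y') := by
  ext i
  · rw [toFreq_fst]
    simp [incl_inl, incl'_inl, flip_apply]
  · rw [toFreq_snd]
    simp [incl_inr, incl'_inr]

theorem ofFreq_eq (k : Φ.K) (ξ η : Rn n) :
    Φ.ofFreq k (ξ, η) = incl ((2 * Real.pi) • Φ.flip k ξ) + incl' ((2 * Real.pi) • η) := by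
  ext (i | i)
  · rw [ofFreq_inl]
    simp [incl_inl, incl'_inl, flip_apply]
  · rw [ofFreq_inr]
    simp [incl_inr, incl'_inr]

theorem toFreq_e (k : Φ.K) (i : Fin n) :
    Φ.toFreq k (e i) = (Φ.sign k i • (2 * Real.pi)⁻¹ • EuclideanSpace.single i (1 : ℝ), 0) := by
  ext j
  · rw [toFreq_fst]
    by_cases h : j = i
    · subst h; simp [e]; ring
    · simp [e, h]
  · rw [toFreq_snd]
    simp [e]

theorem toFreq_e' (k : Φ.K) (i : Fin n) :
    Φ.toFreq k (e' i) = (0, (2 * Real.pi)⁻¹ • EuclideanSpace.single i (1 : ℝ)) := by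
  ext j
  · rw [toFreq_fst]
    simp [e']
  · rw [toFreq_snd]
    by_cases h : j = i
    · subst h; simp [e']
    · simp [e', h]

/-- The right side is the scalar by which `-I(x, v)` acts in coordinate `k`; `toFreq` is designed
for this, absorbing both the signs and the factor `2π`. -/
theorem phase_toFreq (k : Φ.K) (x : Rn n) (v : R2n n) :
    phase x (Φ.toFreq k v) =
      -∑ i, ((x i * v (Sum.inl i) : ℝ) * (I * Φ.sign k i) - (x i * v (Sum.inr i) : ℝ)) := by
  have hpi : (Real.pi : ℂ) ≠ 0 := by exact_mod_cast Real.pi_ne_zero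
  rw [phase_apply, PiLp.inner_apply, PiLp.inner_apply, ← Finset.sum_neg_distrib]
  push_cast
  rw [Finset.mul_sum, ← Finset.sum_sub_distrib, Finset.mul_sum]
  refine Finset.sum_congr rfl fun i _ => ?_
  rw [toFreq_fst, toFreq_snd]
  simp
  field_simp

theorem coord_neg_Iform_mul (x : Rn n) (v : R2n n) (k : Φ.K) (A : G n) :
    Φ.coord k (-Iform (incl x) v * A) = phase x (Φ.toFreq k v) * Φ.coord k A := by
  rw [phase_toFreq, Iform_incl, neg_mul, neg_mul, Finset.sum_mul, Finset.sum_mul, map_neg, map_sum]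
  congr 1
  refine Finset.sum_congr rfl fun i _ => ?_
  rw [sub_mul, smul_mul_assoc, smul_mul_assoc, one_mul, map_sub, map_smul, map_smul, coord_B_mul,
    Complex.real_smul, Complex.real_smul]
  ring

theorem recon_phase_mul (x : Rn n) (v : R2n n) (k : Φ.K) (z : ℂ) :
    Φ.recon k (phase x (Φ.toFreq k v) * z) = -Iform (incl x) v * Φ.recon k z := by
  rw [phase_toFreq, Iform_incl, neg_mul, neg_mul, Finset.sum_mul, Finset.sum_mul, map_neg, map_sum]
  congr 1
  refine Finset.sum_congr rfl fun i _ => ?_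
  rw [sub_mul, sub_mul, smul_mul_assoc, smul_mul_assoc, one_mul, map_sub, mul_assoc,
    ← Complex.real_smul, ← Complex.real_smul, map_smul, map_smul, recon_sign_mul]

theorem coord_integrand (F : Rn n → G n) (v : R2n n) (x : Rn n) (k : Φ.K) :
    Φ.coord k (integrand F v x) = cexp (phase x (Φ.toFreq k v)) * Φ.coord k (F x) :=
  Φ.coord_exp_mul (fun k A => Φ.coord_neg_Iform_mul x v k A) k (F x)

theorem integrand_sum_recon (u : Φ.K → Rn n → ℂ) (v : R2n n) (x : Rn n) :
    integrand (fun x => ∑ k, Φ.recon k (u k x)) v x =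
      ∑ k, Φ.recon k (cexp (phase x (Φ.toFreq k v)) * u k x) := by
  rw [integrand, Finset.mul_sum]
  exact Finset.sum_congr rfl fun k _ => Φ.exp_mul_recon
    (fun k A => Φ.coord_neg_Iform_mul x v k A) (fun k z => Φ.recon_phase_mul x v k z) k (u k x)

theorem norm_sq_enorm (A : G n) : ‖A‖ₑ ^ 2 = ∑ k, ‖Φ.coord k A‖ₑ ^ 2 := by
  simp only [← ofReal_norm, ← ENNReal.ofReal_pow (norm_nonneg _)]
  rw [← Φ.sum_norm_sq A, ENNReal.ofReal_sum_of_nonneg fun _ _ => by positivity]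

end CliffordFrame

/-! ### The measure `m` and its normalization. -/

section NormalizedMeasure

variable {n : ℕ}

/-- The normalizing constant `(2π)^{-n/2}`. -/
def mConst (n : ℕ) : ℝ := (2 * Real.pi) ^ (-(n : ℝ) / 2)

theorem mConst_pos (n : ℕ) : 0 < mConst n := Real.rpow_pos_of_pos (by positivity) _

theorem m_eq : m n = ENNReal.ofReal (mConst n) • volume := rfl

theorem ofReal_mConst_ne_zero : ENNReal.ofReal (mConst n) ≠ 0 := by
  simpa using mConst_pos n

/-- The squared normalizing factor of the transform cancels the Jacobian of the frequency rescaling,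
which makes the transform isometric with respect to `m`. -/
theorem mConst_sq_mul : mConst n ^ 2 * (2 * Real.pi) ^ n = 1 := by
  rw [mConst, ← Real.rpow_natCast, ← Real.rpow_mul (by positivity), ← Real.rpow_natCast,
    ← Real.rpow_add (by positivity)]
  norm_num

theorem ae_m : ae (m n) = ae volume :=
  Measure.ae_ennreal_smul_measure_eq ofReal_mConst_ne_zero _

theorem memLp_m_iff {E : Type*} [NormedAddCommGroup E] {F : Rn n → E} :
    MemLp F 2 (m n) ↔ MemLp F 2 volume := by
  refine ⟨fun h => ?_, fun h => h.smul_measure ENNReal.ofReal_ne_top⟩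
  have := h.smul_measure (c := (ENNReal.ofReal (mConst n))⁻¹)
    (ENNReal.inv_ne_top.2 ofReal_mConst_ne_zero)
  rwa [m_eq, smul_smul, ENNReal.inv_mul_cancel ofReal_mConst_ne_zero ENNReal.ofReal_ne_top,
    one_smul] at this

theorem integrable_m {E : Type*} [NormedAddCommGroup E] {F : Rn n → E} (h : Integrable F) :
    Integrable F (m n) :=
  h.smul_measure ENNReal.ofReal_ne_top

theorem integral_m {E : Type*} [NormedAddCommGroup E] [NormedSpace ℝ E] (F : Rn n → E) :
    ∫ x, F x ∂m n = mConst n • ∫ x, F x := by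
  rw [m_eq, integral_smul_measure, ENNReal.toReal_ofReal (mConst_pos n).le]

theorem lintegral_m (F : Rn n → ℝ≥0∞) :
    ∫⁻ x, F x ∂m n = ENNReal.ofReal (mConst n) * ∫⁻ x, F x := by
  rw [m_eq, lintegral_smul_measure, smul_eq_mul]

theorem lintegral_comp_smul_isometry (S : Rn n ≃ₗᵢ[ℝ] Rn n) {r : ℝ} (hr : 0 < r)
    (g : Rn n → ℝ≥0∞) :
    ∫⁻ y, g (r • S y) = ENNReal.ofReal ((r ^ n)⁻¹) * ∫⁻ y, g y := by
  have h1 : ∫⁻ y, g (r • S y) = ∫⁻ y, g (r • y) :=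
    S.measurePreserving.lintegral_comp_emb S.toHomeomorph.measurableEmbedding fun y => g (r • y)
  have h2 : ∫⁻ y, g (r • y) = ∫⁻ y, g y ∂(Measure.map (r • ·) (volume : Measure (Rn n))) :=
    ((Homeomorph.smulOfNeZero r hr.ne').measurableEmbedding.lintegral_map g).symm
  rw [h1, h2, Measure.map_addHaar_smul _ hr.ne', lintegral_smul_measure, smul_eq_mul]
  simp [abs_of_pos hr]

end NormalizedMeasure

/-! ### Plancherel on slices for functions supported in the octant. -/

section OctantTransform

variable {n : ℕ}

theorem memLp_expMul {u : Rn n → ℂ} (hu : MemLp u 2)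
    (h0 : ∀ᵐ x, x ∉ posOctant n → u x = 0) {η : Rn n} (hη : η ∈ negOctant n) :
    MemLp (expMul η u) 2 := by
  refine hu.of_le (aestronglyMeasurable_expMul hu.1 η) ?_
  filter_upwards [h0] with x hx
  by_cases hxo : x ∈ posOctant n
  · obtain ⟨δ, hδ, h⟩ := exists_inner_le_neg_mul_norm hη
    rw [expMul, norm_mul, Complex.norm_real, Real.norm_of_nonneg (Real.exp_pos _).le]
    refine mul_le_of_le_one_left (norm_nonneg _) (Real.exp_le_one_iff.2 ?_)
    have h1 := h x hxo
    have h2 : 0 ≤ δ * ‖x‖ := by positivity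
    exact mul_nonpos_of_nonneg_of_nonpos (by positivity) (by linarith)
  · simp [expMul, hx hxo]

theorem lintegral_laplaceFourier {u : Rn n → ℂ} (hu : MemLp u 2)
    (h0 : ∀ᵐ x, x ∉ posOctant n → u x = 0) {η : Rn n} (hη : η ∈ negOctant n) :
    ∫⁻ ξ, ‖laplaceFourier u (ξ, η)‖ₑ ^ 2 = ∫⁻ x, ‖expMul η u x‖ₑ ^ 2 := by
  simp only [laplaceFourier_eq_fourier_expMul]
  rw [← eLpNorm_two_sq, ← eLpNorm_two_sq,
    eLpNorm_fourier (expIntegrable_of_memLp hu h0 hη).integrable_expMul (memLp_expMul hu h0 hη)]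

end OctantTransform

/-! ### Direct half: convergence, monogenicity and the norm identity. -/

namespace CliffordFrame

variable {n : ℕ} (Φ : CliffordFrame n)

section Recon

variable {u : Φ.K → Rn n → ℂ} (hu : ∀ k, MemLp (u k) 2)
  (h0 : ∀ k, ∀ᵐ x, x ∉ posOctant n → u k x = 0)

include hu h0

theorem expIntegrable_comp {v : R2n n} (hv : v ∈ tube n) (k : Φ.K) :
    ExpIntegrable (u k) (Φ.toFreq k v).2 :=
  expIntegrable_of_memLp (hu k) (h0 k) (Φ.toFreq_snd_mem.2 hv)

theorem integrable_integrand {v : R2n n} (hv : v ∈ tube n) :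
    Integrable (integrand (fun x => ∑ k, Φ.recon k (u k x)) v) (m n) := by
  have h : integrand (fun x => ∑ k, Φ.recon k (u k x)) v =
      fun x => ∑ k, Φ.reconL k (cexp (phase x (Φ.toFreq k v)) * u k x) :=
    funext fun x => Φ.integrand_sum_recon u v x
  rw [h]
  exact integrable_finsetSum _ fun k _ =>
    (Φ.reconL k).integrable_comp (integrable_m (Φ.expIntegrable_comp hu h0 hv k).integrable)

theorem extTransform_sum_recon {v : R2n n} (hv : v ∈ tube n) :
    extTransform (fun x => ∑ k, Φ.recon k (u k x)) v =
      ∑ k, Φ.reconL k (mConst n • laplaceFourier (u k) (Φ.toFreq k v)) := by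
  have hi := fun k => integrable_m (Φ.expIntegrable_comp hu h0 hv k).integrable
  have h : ∀ x, integrand (fun x => ∑ k, Φ.recon k (u k x)) v x =
      ∑ k, Φ.reconL k (cexp (phase x (Φ.toFreq k v)) * u k x) :=
    fun x => Φ.integrand_sum_recon u v x
  simp only [extTransform, h]
  rw [integral_finsetSum _ fun k _ => (Φ.reconL k).integrable_comp (hi k)]
  refine Finset.sum_congr rfl fun k _ => ?_
  rw [(Φ.reconL k).integral_comp_comm (hi k), integral_m]
  rfl

theorem monogenicOn_extTransform_sum_recon (i : Fin n) :
    MonogenicOn i (extTransform fun x => ∑ k, Φ.recon k (u k x)) (tube n) := by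
  have hH : ∀ k, HolomorphicOnTube (laplaceFourier (u k)) (negOctant n) := fun k =>
    holomorphicOnTube_laplaceFourier isOpen_negOctant fun η hη =>
      expIntegrable_of_memLp (hu k) (h0 k) hη
  let f : R2n n → G n := fun v =>
    ∑ k, Φ.reconL k (mConst n • laplaceFourier (u k) (Φ.toFreq k v))
  have hf : Set.EqOn (extTransform fun x => ∑ k, Φ.recon k (u k x)) f (tube n) :=
    fun v hv => Φ.extTransform_sum_recon hu h0 hv
  have hmaps : ∀ k, Set.MapsTo (Φ.toFreq k) (tube n) {p | p.2 ∈ negOctant n} := fun k v hv =>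
    Φ.toFreq_snd_mem.2 hv
  refine ⟨ContDiffOn.congr (f := f) ?_ hf, fun v hv => ?_⟩
  · exact ContDiffOn.sum fun k _ => (Φ.reconL k).contDiff.comp_contDiffOn
      (((hH k).1.comp (Φ.toFreq k).contDiff.contDiffOn (hmaps k)).const_smul (mConst n))
  · rw [monogenic_iff, (hf.eventuallyEq_of_mem (isOpen_cliffordTube.mem_nhds hv)).fderiv_eq]
    have hd : HasFDerivAt f (∑ k, (Φ.reconL k).comp (mConst n •
        (fderiv ℝ (laplaceFourier (u k)) (Φ.toFreq k v)).comp (Φ.toFreq k))) v := by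
      refine HasFDerivAt.fun_sum fun k _ => (Φ.reconL k).hasFDerivAt.comp v ?_
      exact ((((hH k).differentiableAt isOpen_negOctant (hmaps k hv)).hasFDerivAt).comp v
        (Φ.toFreq k).hasFDerivAt).const_smul (mConst n)
    rw [hd.fderiv]
    simp only [_root_.sum_apply, ContinuousLinearMap.comp_apply,
      _root_.smul_apply, Finset.mul_sum]
    refine Finset.sum_congr rfl fun k _ => ?_
    rw [reconL_apply, reconL_apply, ← recon_sign_mul, toFreq_e, toFreq_e',
      (hH k).2 _ (hmaps k hv)]
    congr 1
    have h1 : ((Φ.sign k i • (2 * Real.pi)⁻¹ • EuclideanSpace.single i (1 : ℝ), 0) :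
        Rn n × Rn n) = Φ.sign k i • ((2 * Real.pi)⁻¹ • EuclideanSpace.single i (1 : ℝ), 0) := by
      simp
    rw [h1, map_smul, Complex.real_smul, Complex.real_smul, Complex.real_smul]
    have h2 : (Φ.sign k i : ℂ) * Φ.sign k i = 1 := by exact_mod_cast Φ.sign_mul_self k i
    linear_combination -(mConst n * I * fderiv ℝ (laplaceFourier (u k)) (Φ.toFreq k v)
      ((2 * Real.pi)⁻¹ • EuclideanSpace.single i (1 : ℝ), 0)) * h2

end Recon

section Isometry

variable {F : Rn n → G n} (hF : MemLp F 2 (m n))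
  (h0 : ∀ᵐ x ∂m n, x ∉ posOctant n → F x = 0)

include hF in
theorem memLp_coord (k : Φ.K) : MemLp (fun x => Φ.coord k (F x)) 2 :=
  (Φ.coordL k).comp_memLp' (memLp_m_iff.1 hF)

include h0 in
theorem coord_eq_zero (k : Φ.K) : ∀ᵐ x, x ∉ posOctant n → Φ.coord k (F x) = 0 := by
  rw [ae_m] at h0
  filter_upwards [h0] with x hx hxo
  rw [hx hxo, map_zero]

theorem eq_sum_recon_coord (F : Rn n → G n) :
    F = fun x => ∑ k, Φ.recon k (Φ.coord k (F x)) :=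
  funext fun x => (Φ.sum_recon (F x)).symm

include Φ hF h0

theorem coord_extTransform {v : R2n n} (hv : v ∈ tube n) (k : Φ.K) :
    Φ.coord k (extTransform F v) =
      mConst n • laplaceFourier (fun x => Φ.coord k (F x)) (Φ.toFreq k v) := by
  have hi : Integrable (integrand F v) (m n) := by
    rw [Φ.eq_sum_recon_coord F]
    exact Φ.integrable_integrand (Φ.memLp_coord hF) (Φ.coord_eq_zero h0) hv
  rw [← coordL_apply, extTransform, ← (Φ.coordL k).integral_comp_comm hi, integral_m]
  simp only [coordL_apply, coord_integrand]
  rfl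

/-- Plancherel in each coordinate, summed by the Parseval identity. The result involves only the
scalar function `‖F‖`, so the scalar Fatou lemma applies to it. -/
theorem lintegral_extTransform {y' : Rn n} (hy' : y' ∈ negOctant n) :
    ∫⁻ y, ‖extTransform F (incl y + incl' y')‖ₑ ^ 2 ∂m n =
      ∫⁻ x, ‖expMul ((2 * Real.pi)⁻¹ • y') (fun x => (‖F x‖ : ℂ)) x‖ₑ ^ 2 ∂m n := by
  have hη : (2 * Real.pi)⁻¹ • y' ∈ negOctant n := fun i =>
    mul_neg_of_pos_of_neg (by positivity) (hy' i)
  have hm := fun k => Φ.memLp_coord hF k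
  have hz := fun k => Φ.coord_eq_zero h0 k
  set η := (2 * Real.pi)⁻¹ • y' with hηd
  have h1 : ∀ k y, ‖Φ.coord k (extTransform F (incl y + incl' y'))‖ₑ ^ 2 =
      ENNReal.ofReal (mConst n) ^ 2 *
        ‖laplaceFourier (fun x => Φ.coord k (F x)) ((2 * Real.pi)⁻¹ • Φ.flip k y, η)‖ₑ ^ 2 := by
    intro k y
    rw [Φ.coord_extTransform hF h0 ⟨y, y', hy', rfl⟩, toFreq_incl_add, enorm_smul, mul_pow,
      Real.enorm_of_nonneg (mConst_pos n).le]
  have hcont : ∀ k, Continuous fun ξ => laplaceFourier (fun x => Φ.coord k (F x)) (ξ, η) :=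
    fun k => (holomorphicOnTube_laplaceFourier isOpen_negOctant fun η hη =>
      expIntegrable_of_memLp (hm k) (hz k) hη).continuous_slice hη
  have h2 : ∀ k, ∫⁻ y, ‖Φ.coord k (extTransform F (incl y + incl' y'))‖ₑ ^ 2 ∂m n =
      ∫⁻ x, ‖expMul η (fun x => Φ.coord k (F x)) x‖ₑ ^ 2 ∂m n := by
    intro k
    simp only [h1]
    rw [lintegral_const_mul' _ _ (by finiteness), lintegral_m, lintegral_m,
      lintegral_comp_smul_isometry (Φ.flip k) (by positivity)
        (fun ξ => ‖laplaceFourier (fun x => Φ.coord k (F x)) (ξ, η)‖ₑ ^ 2),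
      lintegral_laplaceFourier (hm k) (hz k) hη]
    have h3 : ENNReal.ofReal (mConst n) ^ 2 * ENNReal.ofReal ((((2 * Real.pi)⁻¹) ^ n)⁻¹) = 1 := by
      rw [← ENNReal.ofReal_pow (mConst_pos n).le, ← ENNReal.ofReal_mul (by positivity), inv_pow,
        inv_inv, mConst_sq_mul, ENNReal.ofReal_one]
    calc _ = ENNReal.ofReal (mConst n) ^ 2 * ENNReal.ofReal ((((2 * Real.pi)⁻¹) ^ n)⁻¹) *
          (ENNReal.ofReal (mConst n) *
            ∫⁻ x, ‖expMul η (fun x => Φ.coord k (F x)) x‖ₑ ^ 2) := by ring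
      _ = _ := by rw [h3, one_mul]
  calc _ = ∫⁻ y, ∑ k, ‖Φ.coord k (extTransform F (incl y + incl' y'))‖ₑ ^ 2 ∂m n := by
        simp only [Φ.norm_sq_enorm]
    _ = ∑ k, ∫⁻ y, ‖Φ.coord k (extTransform F (incl y + incl' y'))‖ₑ ^ 2 ∂m n := by
        refine lintegral_finsetSum _ fun k _ => ?_
        simp only [h1]
        have := (hcont k).comp ((Φ.flip k).continuous.const_smul (2 * Real.pi)⁻¹)
        exact (this.enorm.measurable.pow_const 2).const_mul _
    _ = ∑ k, ∫⁻ x, ‖expMul η (fun x => Φ.coord k (F x)) x‖ₑ ^ 2 ∂m n :=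
        Finset.sum_congr rfl fun k _ => h2 k
    _ = ∫⁻ x, ∑ k, ‖expMul η (fun x => Φ.coord k (F x)) x‖ₑ ^ 2 ∂m n := by
        refine (lintegral_finsetSum' _ fun k _ => ?_).symm
        exact (aestronglyMeasurable_expMul (memLp_m_iff.2 (hm k)).1 η).enorm.pow_const 2
    _ = _ := by
        refine lintegral_congr fun x => ?_
        simp only [enorm_expMul, mul_pow]
        rw [← Finset.mul_sum, ← Φ.norm_sq_enorm]
        congr 2
        rw [← ofReal_norm, ← ofReal_norm, Complex.norm_real, norm_norm]

/-- The weight is at most `1` on the octant, which bounds the supremum from above; Fatou as `η → 0`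
bounds it from below. -/
theorem supSlice_extTransform : supSlice (extTransform F) = eLpNorm F 2 (m n) ^ 2 := by
  have hN : ∀ x, ‖(‖F x‖ : ℂ)‖ₑ = ‖F x‖ₑ := fun x => by
    rw [← ofReal_norm, ← ofReal_norm, Complex.norm_real, norm_norm]
  rw [eLpNorm_two_sq, supSlice]
  refine le_antisymm (iSup₂_le fun y' hy' => ?_) ?_
  · rw [Φ.lintegral_extTransform hF h0 hy']
    refine lintegral_mono_ae ?_
    filter_upwards [h0] with x hx
    rw [enorm_expMul, hN]
    by_cases hxo : x ∈ posOctant n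
    · gcongr
      refine mul_le_of_le_one_left bot_le (ENNReal.ofReal_le_one.2 (Real.exp_le_one_iff.2 ?_))
      refine mul_nonpos_of_nonneg_of_nonpos (by positivity) ?_
      rw [PiLp.inner_apply]
      refine Finset.sum_nonpos fun i _ => ?_
      have h1 : (2 * Real.pi)⁻¹ * y' i < 0 := mul_neg_of_pos_of_neg (by positivity) (hy' i)
      simpa using mul_nonpos_of_nonpos_of_nonneg h1.le (hxo i).le
    · simp [hx hxo]
  · have hm : AEStronglyMeasurable (fun x => (‖F x‖ : ℂ)) (m n) :=
      Complex.continuous_ofReal.comp_aestronglyMeasurable hF.1.norm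
    simp only [← hN]
    refine lintegral_le_of_lintegral_expMul_le hm fun η hη => ?_
    have hy' : (2 * Real.pi) • η ∈ negOctant n := fun i =>
      mul_neg_of_pos_of_neg (by positivity) (hη i)
    refine le_trans (le_of_eq ?_) (le_iSup₂ ((2 * Real.pi) • η) hy')
    rw [Φ.lintegral_extTransform hF h0 hy', smul_smul, inv_mul_cancel₀ (by positivity), one_smul]

end Isometry

end CliffordFrame

/-! ### Converse half: reconstructing `F` from a monogenic function. -/

namespace CliffordFrame

variable {n : ℕ} (Φ : CliffordFrame n)

theorem ofFreq_snd (k : Φ.K) (b : Rn n) :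
    Φ.ofFreq k (0, b) = ∑ i, (2 * Real.pi * b i) • e' i := by
  ext (i | i)
  · rw [ofFreq_inl]
    simp [e']
  · rw [ofFreq_inr]
    simp [e', Pi.single_apply]

theorem ofFreq_fst (k : Φ.K) (b : Rn n) :
    Φ.ofFreq k (b, 0) = ∑ i, (2 * Real.pi * b i * Φ.sign k i) • e i := by
  ext (i | i)
  · rw [ofFreq_inl]
    simp [e, Pi.single_apply]
    ring
  · rw [ofFreq_inr]
    simp [e]

/-- The sign of `B i` in coordinate `k` is cancelled by the same sign in `ofFreq`, so all
coordinates satisfy the same Cauchy-Riemann equations. -/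
theorem holomorphicOnTube_coord {f : R2n n → G n} (hf1 : ContDiffOn ℝ 1 f (tube n))
    (hf : ∀ i, MonogenicOn i f (tube n)) (k : Φ.K) :
    HolomorphicOnTube (fun p => Φ.coordL k (f (Φ.ofFreq k p))) (negOctant n) := by
  refine ⟨(Φ.coordL k).contDiff.comp_contDiffOn (hf1.comp (Φ.ofFreq k).contDiff.contDiffOn
    fun p hp => Φ.ofFreq_mem_tube hp), fun p hp b => ?_⟩
  have hv := Φ.ofFreq_mem_tube (k := k) hp
  have hd : HasFDerivAt f (fderiv ℝ f (Φ.ofFreq k p)) (Φ.ofFreq k p) :=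
    ((hf1.differentiableOn (by norm_num)).differentiableAt
      (isOpen_cliffordTube.mem_nhds hv)).hasFDerivAt
  have hc : HasFDerivAt (fun p => Φ.coordL k (f (Φ.ofFreq k p)))
      ((Φ.coordL k).comp ((fderiv ℝ f (Φ.ofFreq k p)).comp (Φ.ofFreq k))) p :=
    (Φ.coordL k).hasFDerivAt.comp p (hd.comp p (Φ.ofFreq k).hasFDerivAt)
  rw [hc.fderiv]
  simp only [ContinuousLinearMap.comp_apply, ofFreq_snd, ofFreq_fst, map_sum, map_smul,
    Finset.mul_sum]
  refine Finset.sum_congr rfl fun i _ => ?_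
  rw [(monogenic_iff i _ _).1 ((hf i).2 _ hv), coordL_apply, coordL_apply, coord_B_mul,
    Complex.real_smul, Complex.real_smul]
  push_cast
  ring

/-- Keeping one coordinate loses part of the norm. This is harmless: only finiteness matters here,
and the exact norm comes from the direct half. -/
theorem lintegral_coord_le {f : R2n n → G n} {C : ℝ≥0} (hC : supSlice f = C) (k : Φ.K)
    {η : Rn n} (hη : η ∈ negOctant n) :
    ∫⁻ ξ, ‖Φ.coordL k (f (Φ.ofFreq k (ξ, η)))‖ₑ ^ 2 ≤
      ENNReal.ofReal (((2 * Real.pi) ^ n)⁻¹) * ((ENNReal.ofReal (mConst n))⁻¹ * C) := by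
  have hy' : (2 * Real.pi) • η ∈ negOctant n := fun i =>
    mul_neg_of_pos_of_neg (by positivity) (hη i)
  calc ∫⁻ ξ, ‖Φ.coordL k (f (Φ.ofFreq k (ξ, η)))‖ₑ ^ 2
      ≤ ∫⁻ ξ, ‖f (incl ((2 * Real.pi) • Φ.flip k ξ) + incl' ((2 * Real.pi) • η))‖ₑ ^ 2 := by
        refine lintegral_mono fun ξ => ?_
        rw [ofFreq_eq, Φ.norm_sq_enorm (f _)]
        exact Finset.single_le_sum (f := fun k => ‖Φ.coord k (f _)‖ₑ ^ 2)
          (fun _ _ => bot_le) (Finset.mem_univ k)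
    _ = ENNReal.ofReal (((2 * Real.pi) ^ n)⁻¹) *
          ∫⁻ y, ‖f (incl y + incl' ((2 * Real.pi) • η))‖ₑ ^ 2 :=
        lintegral_comp_smul_isometry (Φ.flip k) (by positivity)
          fun y => ‖f (incl y + incl' ((2 * Real.pi) • η))‖ₑ ^ 2
    _ ≤ _ := by
        gcongr
        rw [← ENNReal.mul_le_iff_le_inv ofReal_mConst_ne_zero ENNReal.ofReal_ne_top, ← lintegral_m,
          ← hC]
        exact le_iSup₂ (f := fun y' (_ : y' ∈ negOctant n) =>
          ∫⁻ y, ‖f (incl y + incl' y')‖ₑ ^ 2 ∂m n) _ hy'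

include Φ

theorem exists_eq_extTransform {f : R2n n → G n} {C : ℝ≥0} (hf1 : ContDiffOn ℝ 1 f (tube n))
    (hf : ∀ i, MonogenicOn i f (tube n)) (hC : supSlice f = C) :
    ∃ F : Rn n → G n, MemLp F 2 (m n) ∧ (∀ x, x ∉ posOctant n → F x = 0) ∧
      ∀ v ∈ tube n, Integrable (integrand F v) (m n) ∧ f v = extTransform F v := by
  have hne : ENNReal.ofReal (((2 * Real.pi) ^ n)⁻¹) * ((ENNReal.ofReal (mConst n))⁻¹ * C) ≠ ⊤ :=
    ENNReal.mul_ne_top ENNReal.ofReal_ne_top (ENNReal.mul_ne_top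
      (ENNReal.inv_ne_top.2 ofReal_mConst_ne_zero) ENNReal.coe_ne_top)
  choose u hu h0 hEq using fun k => exists_eq_laplaceFourier (Φ.holomorphicOnTube_coord hf1 hf k)
    (C := (ENNReal.ofReal (((2 * Real.pi) ^ n)⁻¹) *
      ((ENNReal.ofReal (mConst n))⁻¹ * C)).toNNReal) fun η hη => by
        rw [ENNReal.coe_toNNReal hne]
        exact Φ.lintegral_coord_le hC k hη
  -- The factor compensates for the density of `m`. The `w k` need not be the frame coordinates of
  -- the `F` built from them; `sum_recon` applied to `f v` is enough.
  let w : Φ.K → Rn n → ℂ := fun k x => (mConst n)⁻¹ • u k x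
  have hw : ∀ k, MemLp (w k) 2 := fun k => (hu k).const_smul (mConst n)⁻¹
  have hw0 : ∀ k x, x ∉ posOctant n → w k x = 0 := fun k x hx => by simp [w, h0 k x hx]
  have hw0' : ∀ k, ∀ᵐ x, x ∉ posOctant n → w k x = 0 := fun k => ae_of_all _ (hw0 k)
  refine ⟨fun x => ∑ k, Φ.recon k (w k x), ?_, fun x hx => ?_, fun v hv =>
    ⟨Φ.integrable_integrand hw hw0' hv, ?_⟩⟩
  · rw [memLp_m_iff]
    exact memLp_finsetSum _ fun k _ => (Φ.reconL k).comp_memLp' (hw k)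
  · exact Finset.sum_eq_zero fun k _ => by rw [hw0 k x hx, map_zero]
  · rw [Φ.extTransform_sum_recon hw hw0' hv, ← Φ.sum_recon (f v)]
    refine Finset.sum_congr rfl fun k _ => ?_
    have h1 := hEq k (Φ.toFreq k v).2 (Φ.toFreq_snd_mem.2 hv) (Φ.toFreq k v).1
    simp only [Prod.mk.eta, ofFreq_toFreq] at h1
    have h2 : mConst n • laplaceFourier (w k) (Φ.toFreq k v) =
        laplaceFourier (u k) (Φ.toFreq k v) := by
      simp only [laplaceFourier, w, mul_smul_comm]
      rw [integral_smul, smul_smul, mul_inv_cancel₀ (mConst_pos n).ne', one_smul]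
    rw [h2, ← h1]
    rfl

end CliffordFrame

theorem contDiffOn_tube_of_isEmpty (f : R2n 0 → G 0) : ContDiffOn ℝ 1 f (tube 0) := by
  have : f = fun _ => f 0 := funext fun v => congrArg f (Subsingleton.elim _ _)
  rw [this]
  exact contDiffOn_const

/-- For `n = 0` there is no index from which to draw regularity, but `R2n 0` is a single point. -/
theorem contDiffOn_of_forall_monogenicOn {n : ℕ} {f : R2n n → G n}
    (hf : ∀ i, MonogenicOn i f (tube n)) : ContDiffOn ℝ 1 f (tube n) := by
  cases n with
  | zero => exact contDiffOn_tube_of_isEmpty f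
  | succ n => exact (hf 0).1

end CliffordFourier

end

theorem theorem4p3 (n : ℕ) :
    (∀ F : CliffordFourier.Rn n → CliffordFourier.G n,
      MemLp F 2 (CliffordFourier.m n) →
      (∀ᵐ x ∂CliffordFourier.m n, x ∉ CliffordFourier.posOctant n → F x = 0) →
      (∀ v ∈ CliffordFourier.tube n,
        Integrable (CliffordFourier.integrand F v) (CliffordFourier.m n)) ∧
      (∀ i, CliffordFourier.MonogenicOn i (CliffordFourier.extTransform F)
        (CliffordFourier.tube n)) ∧
      CliffordFourier.supSlice (CliffordFourier.extTransform F) =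
        eLpNorm F 2 (CliffordFourier.m n) ^ 2) ∧
    (∀ (f : CliffordFourier.R2n n → CliffordFourier.G n) (C : ℝ≥0),
      (∀ i, CliffordFourier.MonogenicOn i f (CliffordFourier.tube n)) →
      CliffordFourier.supSlice f = C →
      ∃ F : CliffordFourier.Rn n → CliffordFourier.G n,
        MemLp F 2 (CliffordFourier.m n) ∧
        (∀ x, x ∉ CliffordFourier.posOctant n → F x = 0) ∧
        (∀ v ∈ CliffordFourier.tube n,
          Integrable (CliffordFourier.integrand F v) (CliffordFourier.m n) ∧
          f v = CliffordFourier.extTransform F v) ∧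
        (C : ℝ≥0∞) = eLpNorm F 2 (CliffordFourier.m n) ^ 2) := by
  obtain ⟨Φ⟩ := CliffordFourier.nonempty_cliffordFrame n
  refine ⟨fun F hF h0 => ⟨fun v hv => ?_, fun i => ?_, ?_⟩, fun f C hf hC => ?_⟩
  · rw [CliffordFourier.CliffordFrame.eq_sum_recon_coord Φ F]
    exact CliffordFourier.CliffordFrame.integrable_integrand Φ
      (CliffordFourier.CliffordFrame.memLp_coord Φ hF)
      (CliffordFourier.CliffordFrame.coord_eq_zero Φ h0) hv
  · rw [CliffordFourier.CliffordFrame.eq_sum_recon_coord Φ F]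
    exact CliffordFourier.CliffordFrame.monogenicOn_extTransform_sum_recon Φ
      (CliffordFourier.CliffordFrame.memLp_coord Φ hF)
      (CliffordFourier.CliffordFrame.coord_eq_zero Φ h0) i
  · exact CliffordFourier.CliffordFrame.supSlice_extTransform Φ hF h0
  · obtain ⟨F, hF, h0, hv⟩ := CliffordFourier.CliffordFrame.exists_eq_extTransform Φ
      (CliffordFourier.contDiffOn_of_forall_monogenicOn hf) hf hC
    refine ⟨F, hF, h0, hv, ?_⟩
    -- The norm identity is the direct half applied to the `F` just found, since `f` and its
    -- transform agree on the tube.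
    rw [← CliffordFourier.CliffordFrame.supSlice_extTransform Φ hF (Filter.Eventually.of_forall h0),
      ← hC, CliffordFourier.supSlice, CliffordFourier.supSlice]
    refine iSup_congr fun y' => iSup_congr fun hy' => lintegral_congr fun y => ?_
    rw [(hv _ ⟨y, y', hy', rfl⟩).2]
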